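/- Let $C\in\mathbb R^{n_y\times n_x}$, $D\in\mathbb R^{n_y\times n_y}$ with $DD^T\succ0$, let $X\sim N(0,Q_X)$ with $Q_X\succ 0$ and $V\sim N(0,I)$ be independent, and let $Y=CX+DV$. Put $Q_{X,Y}=Q_XC^T$, $Q_Y=CQ_XC^T+DD^T$, $Q_{X|Y}=Q_X-Q_{X,Y}Q_Y^{-1}Q_{X,Y}^T$ (which is positive definite). Let $\mathcal S=\{\Sigma:\ 0\preceq\Sigma\preceq Q_{X|Y}\}$ and $\mathcal Q(\Delta)=\{\Sigma\in\mathcal S:\ \operatorname{tr}\Sigma\le\Delta\}$. For $\Sigma_\Delta\in\mathcal S$ put $H=I-\Sigma_\Delta Q_{X|Y}^{-1}$, $Q_W=H\Sigma_\Delta=\Sigma_\Delta-\Sigma_\Delta Q_{X|Y}^{-1}\Sigma_\Delta$, let $W\sim N(0,Q_W)$ be independent of $(X,V)$ and $\widehat X=HX+(I-H)Q_{X,Y}Q_Y^{-1}Y+W$. Let $\mathbf X=X-\mathbf E[X|Y]$, $\widehat{\mathbf X}=\widehat X-\mathbf E[\widehat X|Y]$, let $Q_{X|Y}=U\operatorname{diag}(\lambda_1,\dots,\lambda_{n_x})U^T$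 with $U$ orthogonal and $\lambda_1\ge\dots\ge\lambda_{n_x}$, and let $\overline{\mathbf X}=U^T\mathbf X$, $\widehat{\overline{\mathbf X}}=U^T\widehat{\mathbf X}$. The conditional rate distortion function is $R_{X|Y}(\Delta)=\inf I(X;\widehat Z|Y)$, the infimum over all joint laws of $(X,Y,\widehat Z)$ with the given law of $(X,Y)$ and $\mathbf E\|X-\widehat Z\|^2\le\Delta$. Information is in nats with values in $[0,\infty]$; $\tfrac12\log\max\{1,\det(Q\Sigma^{-1})\}=\infty$ if $\Sigma$ is singular, $\tfrac12\log\max\{1,\lambda/\delta\}=\infty$ if $\delta=0$, and $\inf\emptyset=\infty$. (1) $\mathbf X=X-Q_{X,Y}Q_Y^{-1}Y$ a.s. and $\mathbf E[\mathbf X\mathbf X^T]=Q_{X|Y}$. For every $\Sigma_\Delta\in\mathcal S$: $\widehat{\mathbf X}=\widehat X-Q_{X,Y}Q_Y^{-1}Y=H\mathbf X+W$ a.s.; $I(X;\widehat X|Y)=I(\mathbf X;\widehat{\mathbf X})=I(U^T\mathbf X;U^T\widehat{\mathbf X})\ge\sum_t I(\overline{\mathbf X}_t;\widehat{\overline{\mathbf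 X}}_t)$; $\mathbf E[(X-\widehat X)(X-\widehat X)^T]=\Sigma_\Delta$; and $\mathbf E\|X-\widehat X\|^2=\mathbf E\|\mathbf X-\widehat{\mathbf X}\|^2=\mathbf E\|U^T\mathbf X-U^T\widehat{\mathbf X}\|^2=\operatorname{tr}\Sigma_\Delta$. (2) For every $\Delta\ge0$, $$R_{X|Y}(\Delta)=\inf_{\mathcal Q(\Delta)}I(X;\widehat X|Y)=\inf_{\Sigma\in\mathcal Q(\Delta)}\tfrac12\log\max\{1,\det(Q_{X|Y}\Sigma^{-1})\}=\inf_{\mathbf E\|\mathbf X-\widehat{\mathbf X}\|^2\le\Delta}I(\mathbf X;\widehat{\mathbf X})=\inf_{\mathbf E\|U^T\mathbf X-U^T\widehat{\mathbf X}\|^2\le\Delta}I(U^T\mathbf X;U^T\widehat{\mathbf X})\ge\inf_{\mathbf E\|U^T\mathbf X-U^T\widehat{\mathbf X}\|^2\le\Delta}\sum_{t}I(\overline{\mathbf X}_t;\widehat{\overline{\mathbf X}}_t).$$ The last three infima may be taken either over the above channels with $\Sigma_\Delta\in\mathcal S$ or over all joint laws of the source ($\mathbf X$ or $U^T\mathbf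 X$) and a reproduction that satisfy the distortion constraint. (3) If $\Sigma_\Delta\in\mathcal S$ commutes with $Q_{X|Y}$, then $H=H^T\succeq0$, and there are an orthogonal $U_1$ and reals $\delta_i$ with $Q_{X|Y}=U_1\operatorname{diag}(\lambda_i)U_1^T$, $\Sigma_\Delta=U_1\operatorname{diag}(\delta_i)U_1^T$ and $I(U_1^T\mathbf X;U_1^T\widehat{\mathbf X})=\sum_t I((U_1^T\mathbf X)_t;(U_1^T\widehat{\mathbf X})_t)$. Whenever $U$ itself satisfies $\Sigma_\Delta=U\operatorname{diag}(\delta_i)U^T$, then $\mathbf E[(\overline{\mathbf X}-\widehat{\overline{\mathbf X}})(\overline{\mathbf X}-\widehat{\overline{\mathbf X}})^T]=\operatorname{diag}(\delta_i)$, $I(\overline{\mathbf X};\widehat{\overline{\mathbf X}})=\sum_tI(\overline{\mathbf X}_t;\widehat{\overline{\mathbf X}}_t)$ and $I(X;\widehat X|Y)=\tfrac12\sum_i\log\max\{1,\lambda_i/\delta_i\}$. (4) For every $\Delta\ge0$, the infima in (2) of $I(X;\widehat X|Y)$ over $\mathcal Q(\Delta)$ and of $\sum_tI(\overline{\mathbf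 X}_t;\widehat{\overline{\mathbf X}}_t)$ do not change when only the $\Sigma_\Delta\in\mathcal Q(\Delta)$ that commute with $Q_{X|Y}$ are admitted, the inequality in (2) is an equality (for the channels and for all joint laws), and $$R_{X|Y}(\Delta)=\inf_{\delta_i\ge0,\ \sum_i\delta_i\le\Delta}\ \tfrac12\sum_{i=1}^{n_x}\log\max\{1,\lambda_i/\delta_i\},$$ which is also the infimum over the commuting $\Sigma_\Delta\in\mathcal Q(\Delta)$ with $\delta_i=\mathbf E(\overline{\mathbf X}_i-\widehat{\overline{\mathbf X}}_i)^2$. -/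

import Mathlib

open MeasureTheory ProbabilityTheory InformationTheory
open scoped ENNReal Matrix

noncomputable section

namespace GaussRDF

/-- The action of a real matrix on Euclidean column vectors. -/
def matVec {m n : ℕ} (A : Matrix (Fin m) (Fin n) ℝ) (x : EuclideanSpace ℝ (Fin n)) :
    EuclideanSpace ℝ (Fin m) :=
  WithLp.toLp 2 (A *ᵥ WithLp.ofLp x)

/-! ### Information measures (in nats) -/

/-- Mutual information `I(X; Z)`: the divergence of the joint law from the product of the
marginal laws. -/
def mutualInfo {Ω 𝓧 𝓩 : Type*} [MeasurableSpace Ω] [MeasurableSpace 𝓧] [MeasurableSpace 𝓩]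
    (P : Measure Ω) (X : Ω → 𝓧) (Z : Ω → 𝓩) : ℝ≥0∞ :=
  klDiv (P.map fun ω => (X ω, Z ω)) ((P.map X).prod (P.map Z))

/-- Conditional mutual information `I(X; Z | Y)`: the divergence of the law of `(Y, (X, Z))` from
the law under which `Y` has its own law and, given `Y`, the variables `X` and `Z` are independent
with their given conditional laws. -/
def condMutualInfo {Ω 𝓧 𝓩 𝓨 : Type*} [MeasurableSpace Ω]
    [MeasurableSpace 𝓧] [StandardBorelSpace 𝓧] [Nonempty 𝓧]
    [MeasurableSpace 𝓩] [StandardBorelSpace 𝓩] [Nonempty 𝓩] [MeasurableSpace 𝓨]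
    (P : Measure Ω) [IsFiniteMeasure P] (X : Ω → 𝓧) (Z : Ω → 𝓩) (Y : Ω → 𝓨) : ℝ≥0∞ :=
  klDiv (P.map fun ω => (Y ω, (X ω, Z ω)))
    (Measure.compProd (P.map Y) (Kernel.prod (condDistrib X Y P) (condDistrib Z Y P)))

/-- Mean-square distortion `E‖X - Z‖²`, with the value `∞` if it is infinite. -/
def distortion {Ω : Type*} [MeasurableSpace Ω] {n : ℕ} (P : Measure Ω)
    (X Z : Ω → EuclideanSpace ℝ (Fin n)) : ℝ≥0∞ :=
  ∫⁻ ω, ENNReal.ofReal (‖X ω - Z ω‖ ^ 2) ∂P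

/-- `E[Z Zᵀ] = S`, including the integrability of all entries. -/
def HasSecondMoment {Ω : Type*} [MeasurableSpace Ω] {n : ℕ} (P : Measure Ω)
    (Z : Ω → EuclideanSpace ℝ (Fin n)) (S : Matrix (Fin n) (Fin n) ℝ) : Prop :=
  ∀ i j, Integrable (fun ω => Z ω i * Z ω j) P ∧ ∫ ω, Z ω i * Z ω j ∂P = S i j

/-- The conditional mean `E[X | Y]`, as a random variable. -/
def condMean {Ω 𝓨 : Type*} [MeasurableSpace Ω] [m𝓨 : MeasurableSpace 𝓨] {n : ℕ} (P : Measure Ω)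
    (X : Ω → EuclideanSpace ℝ (Fin n)) (Y : Ω → 𝓨) : Ω → EuclideanSpace ℝ (Fin n) :=
  P[X | m𝓨.comap Y]

/-- The translated variable `X - E[X | Y]`. -/
def centered {Ω 𝓨 : Type*} [MeasurableSpace Ω] [MeasurableSpace 𝓨] {n : ℕ} (P : Measure Ω)
    (X : Ω → EuclideanSpace ℝ (Fin n)) (Y : Ω → 𝓨) : Ω → EuclideanSpace ℝ (Fin n) :=
  fun ω => X ω - condMean P X Y ω

/-! ### Rate distortion functions with mean-square distortion -/

/-- The conditional rate distortion function of a source with joint law `ρ = P_{X,Y}`: the infimum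
of `I(X; X̂ | Y)` over all joint laws `π` of `(X, Y, X̂)` for which `(X, Y)` has law `ρ` and
`E‖X - X̂‖² ≤ Δ`. -/
def condRDF {nx ny : ℕ}
    (ρ : Measure (EuclideanSpace ℝ (Fin nx) × EuclideanSpace ℝ (Fin ny))) (Δ : ℝ) : ℝ≥0∞ :=
  ⨅ (π : Measure
      (EuclideanSpace ℝ (Fin nx) × EuclideanSpace ℝ (Fin ny) × EuclideanSpace ℝ (Fin nx)))
    (_ : IsProbabilityMeasure π)
    (_ : π.map (fun p => (p.1, p.2.1)) = ρ)
    (_ : distortion π (fun p => p.1) (fun p => p.2.2) ≤ ENNReal.ofReal Δ),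
    condMutualInfo π (fun p => p.1) (fun p => p.2.2) (fun p => p.2.1)

/-- The marginal rate distortion function of a source with law `ν`: the infimum of `I(X; X̂)` over
all joint laws `π` of `(X, X̂)` for which `X` has law `ν` and `E‖X - X̂‖² ≤ Δ`. -/
def marginalRDF {n : ℕ} (ν : Measure (EuclideanSpace ℝ (Fin n))) (Δ : ℝ) : ℝ≥0∞ :=
  ⨅ (π : Measure (EuclideanSpace ℝ (Fin n) × EuclideanSpace ℝ (Fin n)))
    (_ : IsProbabilityMeasure π)
    (_ : π.map (fun p => p.1) = ν)
    (_ : distortion π (fun p => p.1) (fun p => p.2) ≤ ENNReal.ofReal Δ),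
    mutualInfo π (fun p => p.1) (fun p => p.2)

/-- The same infimum with the sum of the coordinatewise mutual informations
`∑ t, I(X_t; X̂_t)` as objective. -/
def coordRDF {n : ℕ} (ν : Measure (EuclideanSpace ℝ (Fin n))) (Δ : ℝ) : ℝ≥0∞ :=
  ⨅ (π : Measure (EuclideanSpace ℝ (Fin n) × EuclideanSpace ℝ (Fin n)))
    (_ : IsProbabilityMeasure π)
    (_ : π.map (fun p => p.1) = ν)
    (_ : distortion π (fun p => p.1) (fun p => p.2) ≤ ENNReal.ofReal Δ),
    ∑ t, mutualInfo π (fun p => p.1 t) (fun p => p.2 t)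

/-- `½ log max {1, det (Q S⁻¹)}`, equal to `∞` if `S` is singular. -/
def detRate {n : ℕ} (Q S : Matrix (Fin n) (Fin n) ℝ) : ℝ≥0∞ :=
  if S.det = 0 then ⊤ else ENNReal.ofReal (1 / 2 * Real.log (max 1 (Q * S⁻¹).det))

/-- `½ log max {1, l / d}`, equal to `∞` if `d = 0`. -/
def scalarRate (l d : ℝ) : ℝ≥0∞ :=
  if d = 0 then ⊤ else ENNReal.ofReal (1 / 2 * Real.log (max 1 (l / d)))

/-! ### The matrices of the Gaussian source `Y = C X + D V` and of the test channel -/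

/-- `Q_{X,Y} = Q_X Cᵀ`. -/
def crossCov {nx ny : ℕ} (QX : Matrix (Fin nx) (Fin nx) ℝ) (C : Matrix (Fin ny) (Fin nx) ℝ) :
    Matrix (Fin nx) (Fin ny) ℝ :=
  QX * Cᵀ

/-- `Q_Y = C Q_X Cᵀ + D Dᵀ`. -/
def sideCov {nx ny : ℕ} (QX : Matrix (Fin nx) (Fin nx) ℝ) (C : Matrix (Fin ny) (Fin nx) ℝ)
    (D : Matrix (Fin ny) (Fin ny) ℝ) : Matrix (Fin ny) (Fin ny) ℝ :=
  C * QX * Cᵀ + D * Dᵀ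

/-- The regression matrix `Q_{X,Y} Q_Y⁻¹`. -/
def regression {nx ny : ℕ} (QX : Matrix (Fin nx) (Fin nx) ℝ) (C : Matrix (Fin ny) (Fin nx) ℝ)
    (D : Matrix (Fin ny) (Fin ny) ℝ) : Matrix (Fin nx) (Fin ny) ℝ :=
  crossCov QX C * (sideCov QX C D)⁻¹

/-- `Q_{X|Y} = Q_X - Q_{X,Y} Q_Y⁻¹ Q_{X,Y}ᵀ`. -/
def condCov {nx ny : ℕ} (QX : Matrix (Fin nx) (Fin nx) ℝ) (C : Matrix (Fin ny) (Fin nx) ℝ)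
    (D : Matrix (Fin ny) (Fin ny) ℝ) : Matrix (Fin nx) (Fin nx) ℝ :=
  QX - crossCov QX C * (sideCov QX C D)⁻¹ * (crossCov QX C)ᵀ

/-- `H = I - S Q⁻¹`. -/
def gain {n : ℕ} (Q S : Matrix (Fin n) (Fin n) ℝ) : Matrix (Fin n) (Fin n) ℝ :=
  1 - S * Q⁻¹

/-- `Q_W = H S = S - S Q⁻¹ S`. -/
def noiseCov {n : ℕ} (Q S : Matrix (Fin n) (Fin n) ℝ) : Matrix (Fin n) (Fin n) ℝ :=
  gain Q S * S

/-- The error covariances `S` with `0 ≼ S ≼ Q`. -/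
def errorCovs {n : ℕ} (Q : Matrix (Fin n) (Fin n) ℝ) : Set (Matrix (Fin n) (Fin n) ℝ) :=
  {S | S.PosSemidef ∧ (Q - S).PosSemidef}

/-- The error covariances `S` with `0 ≼ S ≼ Q` and `tr S ≤ Δ`. -/
def feasible {n : ℕ} (Q : Matrix (Fin n) (Fin n) ℝ) (Δ : ℝ) : Set (Matrix (Fin n) (Fin n) ℝ) :=
  {S | S ∈ errorCovs Q ∧ S.trace ≤ Δ}

end GaussRDF

end

namespace GaussRDF

/-! ### Divergence -/

section Divergence

variable {α β : Type*} [MeasurableSpace α] [MeasurableSpace β]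

/-! All rate functions in the theorem are squeezed into one closed circle of inequalities. With `B`
the regression matrix, T = X - BY is Gaussian with covariance Q and independent of Y.

Lower bounds hold for arbitrary joint laws. Subtracting BY from source and reproduction keeps their
difference, and by data processing it does not increase the information, because the reference law
of the conditional divergence is carried to a product law. So the conditional problem dominates the
unconditional one for T. Rotation by Uᵀ keeps the distortion and gives a source with independent
components of variances λ_i. Mutual information is superadditive for such a source
(`sum_mutualInfo_le`), and each coordinate obeys the scalar Gaussian bound
(`scalarRate_le_mutualInfo`). What remains is the allocation problem `diagRDF`: share the budget Δ
among the coordinates. Both bounds come from Gibbs' inequality `integral_log_le_klDiv`, applied to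
the product of the pairwise densities and to the Gaussian backward channel respectively.

The upper bound comes from the test channels. Their moments satisfy E[T Zᵀ] = E[Z Zᵀ] = Q - S, so T
= Z + N with N Gaussian of covariance S and independent of Z. When S is diagonal in the basis U, the
coordinate pairs are independent and Gibbs' inequality is an equality in each, so the cost is the
sum of the scalar rates. Capping an allocation δ at λ yields an admissible S at the same cost.

Hence `diagRDF` ≤ `coordRDF` of the rotated source ≤ `marginalRDF` of the rotated source ≤
`marginalRDF` of the centered source ≤ `condRDF` ≤ `diagRDF`. Every infimum over error covariances
is bounded below by `diagRDF` and takes the same values at diagonal covariances, so it equals it too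
(`diagRDF_eq_biInf`). For the determinant rate the lower bound is Hadamard's inequality. -/

lemma klDiv_map_measurableEquiv (μ ν : Measure α) [IsFiniteMeasure μ] [IsFiniteMeasure ν]
    (e : α ≃ᵐ β) : klDiv (μ.map e) (ν.map e) = klDiv μ ν := by
  refine le_antisymm (klDiv_map_le μ ν e.measurable) ?_
  have h := klDiv_map_le (μ.map e) (ν.map e) e.symm.measurable
  simpa [Measure.map_map e.symm.measurable e.measurable] using h

/-- Gibbs' inequality: the expected logarithm of a subprobability density bounds the divergence
from below. -/
lemma integral_log_le_klDiv {μ ν : Measure α} [IsProbabilityMeasure μ] [IsProbabilityMeasure ν]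
    {g : α → ℝ≥0∞} (hg : Measurable g) (hg1 : ∫⁻ x, g x ∂ν ≤ 1)
    (hpos : ∀ᵐ x ∂μ, g x ≠ 0) (hint : Integrable (fun x => Real.log (g x).toReal) μ) :
    ENNReal.ofReal (∫ x, Real.log (g x).toReal ∂μ) ≤ klDiv μ ν := by
  by_cases htop : klDiv μ ν = ⊤
  · simp [htop]
  obtain ⟨hac, hllr⟩ := klDiv_ne_top_iff.1 htop
  rw [klDiv_of_ac_of_integrable hac hllr]
  refine ENNReal.ofReal_le_ofReal ?_
  set r := μ.rnDeriv ν with hr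
  have hrm : Measurable r := Measure.measurable_rnDeriv μ ν
  have hqm : Measurable fun x => g x / r x := hg.div hrm
  -- The ratio of the test density to the true density has mean at most one under μ. With log t ≤ t
  -- - 1 this gives E log g - E log r ≤ 0.
  have h1 : ∫⁻ x, g x / r x ∂μ ≤ 1 := by
    rw [← lintegral_rnDeriv_mul hac hqm.aemeasurable]
    exact (lintegral_mono fun x => ENNReal.mul_div_le).trans hg1
  have hfin : ∀ᵐ x ∂μ, g x / r x < ⊤ :=
    ae_lt_top hqm (ne_top_of_le_ne_top ENNReal.one_ne_top h1)
  have hu : Integrable (fun x => (g x / r x).toReal) μ :=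
    integrable_toReal_of_lintegral_ne_top hqm.aemeasurable
      (ne_top_of_le_ne_top ENNReal.one_ne_top h1)
  have hu1 : ∫ x, (g x / r x).toReal ∂μ ≤ 1 := by
    rw [integral_toReal hqm.aemeasurable hfin]
    exact ENNReal.toReal_mono ENNReal.one_ne_top h1
  have hgfin : ∀ᵐ x ∂μ, g x < ⊤ :=
    hac.ae_le (ae_lt_top hg (ne_top_of_le_ne_top ENNReal.one_ne_top hg1))
  have hrpos : ∀ᵐ x ∂μ, 0 < r x := Measure.rnDeriv_pos hac
  have hrfin : ∀ᵐ x ∂μ, r x < ⊤ := hac.ae_le (Measure.rnDeriv_lt_top μ ν)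
  have hle : ∫ x, (Real.log (g x).toReal - llr μ ν x) ∂μ ≤ ∫ x, ((g x / r x).toReal - 1) ∂μ := by
    refine integral_mono_ae (hint.sub hllr) (hu.sub (integrable_const 1)) ?_
    filter_upwards [hpos, hgfin, hrpos, hrfin] with x h1 h2 h3 h4
    have hg0 : 0 < (g x).toReal := ENNReal.toReal_pos h1 h2.ne
    have hr0 : 0 < (r x).toReal := ENNReal.toReal_pos h3.ne' h4.ne
    have hlog : Real.log (g x).toReal - llr μ ν x = Real.log ((g x).toReal / (r x).toReal) := by
      rw [Real.log_div hg0.ne' hr0.ne']; rfl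
    simp only [hlog, ENNReal.toReal_div]
    exact Real.log_le_sub_one_of_pos (div_pos hg0 hr0)
  rw [integral_sub hint hllr, integral_sub hu (integrable_const 1)] at hle
  simp only [integral_const, probReal_univ, smul_eq_mul, mul_one] at hle ⊢
  linarith

lemma klDiv_withDensity {μ ν : Measure α} [IsProbabilityMeasure μ] [IsProbabilityMeasure ν]
    {g : α → ℝ≥0∞} (hg : Measurable g) (hμ : μ = ν.withDensity g)
    (hint : Integrable (fun x => Real.log (g x).toReal) μ) :
    klDiv μ ν = ENNReal.ofReal (∫ x, Real.log (g x).toReal ∂μ) := by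
  have hac : μ ≪ ν := hμ ▸ withDensity_absolutelyContinuous ν g
  have hr : μ.rnDeriv ν =ᵐ[μ] g := hac.ae_le (hμ ▸ Measure.rnDeriv_withDensity ν hg)
  have hllr : llr μ ν =ᵐ[μ] fun x => Real.log (g x).toReal := by
    filter_upwards [hr] with x hx
    simp [llr, hx]
  rw [klDiv_of_ac_of_integrable hac ((integrable_congr hllr).2 hint), integral_congr_ae hllr]
  simp

/-- A common independent factor carries no divergence. After swapping the factors, this is
cancellation of a common constant kernel. -/
lemma klDiv_prod_left (ρ : Measure β) [IsProbabilityMeasure ρ] (μ ν : Measure α)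
    [IsProbabilityMeasure μ] [IsProbabilityMeasure ν] :
    klDiv (ρ.prod μ) (ρ.prod ν) = klDiv μ ν := by
  have h := klDiv_compProd_left μ ν (Kernel.const α ρ)
  rw [Measure.compProd_const, Measure.compProd_const] at h
  rw [← h, ← klDiv_map_measurableEquiv (μ.prod ρ) (ν.prod ρ) MeasurableEquiv.prodComm]
  congr 1 <;> exact Measure.prod_swap.symm

end Divergence

/-! ### Divergence of finite product measures -/

section Pi

variable {ι : Type*} [Fintype ι] {α β : ι → Type*} [∀ i, MeasurableSpace (α i)]
  [∀ i, MeasurableSpace (β i)]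

lemma lintegral_pi_prod (μ : ∀ i, Measure (α i)) [∀ i, IsProbabilityMeasure (μ i)]
    {f : ∀ i, α i → ℝ≥0∞} (hf : ∀ i, Measurable (f i)) :
    ∫⁻ x, ∏ i, f i (x i) ∂(Measure.pi μ) = ∏ i, ∫⁻ x, f i x ∂(μ i) := by
  have hind : iIndepFun (fun i (x : ∀ i, α i) => f i (x i)) (Measure.pi μ) :=
    iIndepFun_pi (fun i => (hf i).aemeasurable)
  rw [lintegral_prod_eq_prod_lintegral_of_indepFun _ _ hind
    (fun i => (hf i).comp (measurable_pi_apply i))]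
  refine Finset.prod_congr rfl fun i _ => ?_
  exact (measurePreserving_eval μ i).lintegral_comp (hf i)

lemma pi_withDensity (μ : ∀ i, Measure (α i)) [∀ i, IsProbabilityMeasure (μ i)]
    {f : ∀ i, α i → ℝ≥0∞} (hf : ∀ i, Measurable (f i))
    [∀ i, IsProbabilityMeasure ((μ i).withDensity (f i))] :
    Measure.pi (fun i => (μ i).withDensity (f i)) =
      (Measure.pi μ).withDensity fun x => ∏ i, f i (x i) := by
  refine Measure.pi_eq fun s hs => ?_
  rw [withDensity_apply _ (.univ_pi hs), ← lintegral_indicator (.univ_pi hs)]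
  have h : ∀ x : ∀ i, α i, (Set.univ.pi s).indicator (fun x => ∏ i, f i (x i)) x =
      ∏ i, (s i).indicator (f i) (x i) := by
    intro x
    by_cases hx : x ∈ Set.univ.pi s
    · rw [Set.indicator_of_mem hx]
      exact Finset.prod_congr rfl fun i _ => (Set.indicator_of_mem (hx i trivial) _).symm
    · rw [Set.indicator_of_notMem hx]
      obtain ⟨i, hi⟩ : ∃ i, x i ∉ s i := by simpa [Set.mem_pi] using hx
      exact (Finset.prod_eq_zero (Finset.mem_univ i) (Set.indicator_of_notMem hi _)).symm
  simp_rw [h]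
  rw [lintegral_pi_prod μ fun i => (hf i).indicator (hs i)]
  refine Finset.prod_congr rfl fun i _ => ?_
  rw [lintegral_indicator (hs i), withDensity_apply _ (hs i)]

/-- The density of the product is the product of the densities, so the log-likelihood ratio is a
sum. Only the upper bound is needed, which makes the case of an infinite summand trivial. -/
lemma klDiv_pi_le (μ ν : ∀ i, Measure (α i)) [∀ i, IsProbabilityMeasure (μ i)]
    [∀ i, IsProbabilityMeasure (ν i)] :
    klDiv (Measure.pi μ) (Measure.pi ν) ≤ ∑ i, klDiv (μ i) (ν i) := by
  by_cases htop : ∑ i, klDiv (μ i) (ν i) = ⊤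
  · simp [htop]
  have hfin : ∀ i, klDiv (μ i) (ν i) ≠ ⊤ := fun i =>
    ENNReal.sum_ne_top.1 htop i (Finset.mem_univ i)
  have hac : ∀ i, μ i ≪ ν i := fun i => (klDiv_ne_top_iff.1 (hfin i)).1
  have hint : ∀ i, Integrable (llr (μ i) (ν i)) (μ i) := fun i => (klDiv_ne_top_iff.1 (hfin i)).2
  have hwd : ∀ i, (ν i).withDensity ((μ i).rnDeriv (ν i)) = μ i := fun i =>
    Measure.withDensity_rnDeriv_eq _ _ (hac i)
  have hm : ∀ i, Measurable ((μ i).rnDeriv (ν i)) := fun i => Measure.measurable_rnDeriv _ _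
  have : ∀ i, IsProbabilityMeasure ((ν i).withDensity ((μ i).rnDeriv (ν i))) := fun i => by
    rw [hwd i]; infer_instance
  have hpi : Measure.pi μ =
      (Measure.pi ν).withDensity fun x => ∏ i, (μ i).rnDeriv (ν i) (x i) := by
    rw [← pi_withDensity ν hm]
    simp_rw [hwd]
  have hlog : (fun x : ∀ i, α i => Real.log (∏ i, (μ i).rnDeriv (ν i) (x i)).toReal)
      =ᵐ[Measure.pi μ] fun x => ∑ i, llr (μ i) (ν i) (x i) := by
    have h : ∀ᵐ x ∂(Measure.pi μ), ∀ i, 0 < (μ i).rnDeriv (ν i) (x i) ∧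
        (μ i).rnDeriv (ν i) (x i) < ⊤ := by
      rw [ae_all_iff]
      intro i
      have h' : ∀ᵐ y ∂(μ i), 0 < (μ i).rnDeriv (ν i) y ∧ (μ i).rnDeriv (ν i) y < ⊤ := by
        filter_upwards [Measure.rnDeriv_pos (hac i),
          (hac i).ae_le (Measure.rnDeriv_lt_top (μ i) (ν i))] with x h1 h2 using ⟨h1, h2⟩
      exact (measurePreserving_eval μ i).quasiMeasurePreserving.ae h'
    filter_upwards [h] with x hx
    rw [ENNReal.toReal_prod, Real.log_prod
      (fun i _ => (ENNReal.toReal_pos (hx i).1.ne' (hx i).2.ne).ne')]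
    rfl
  have hinti : ∀ i, Integrable (fun x : ∀ i, α i => llr (μ i) (ν i) (x i)) (Measure.pi μ) :=
    fun i => (measurePreserving_eval μ i).integrable_comp_of_integrable (hint i)
  have hgm : Measurable fun x : ∀ i, α i => ∏ i, (μ i).rnDeriv (ν i) (x i) :=
    Finset.measurable_fun_prod _ fun i _ => (hm i).comp (measurable_pi_apply i)
  rw [klDiv_withDensity hgm hpi ((integrable_congr hlog).2 (integrable_finsetSum _ fun i _ => hinti i)),
    integral_congr_ae hlog, integral_finsetSum _ fun i _ => hinti i]
  have heq : ∀ i, ∫ x : ∀ i, α i, llr (μ i) (ν i) (x i) ∂(Measure.pi μ) =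
      ∫ x, llr (μ i) (ν i) x ∂(μ i) := fun i => by
    have h := integral_map (μ := Measure.pi μ) (φ := Function.eval i) (f := llr (μ i) (ν i))
      (measurable_pi_apply i).aemeasurable
      (by rw [(measurePreserving_eval μ i).map_eq]; exact (hint i).1)
    rw [(measurePreserving_eval μ i).map_eq] at h
    exact h.symm
  simp_rw [heq]
  rw [ENNReal.ofReal_sum_of_nonneg fun i _ => by
    simpa using integral_llr_add_sub_measure_univ_nonneg (hac i) (hint i)]
  refine Finset.sum_le_sum fun i _ => ?_
  rw [klDiv_of_ac_of_integrable (hac i) (hint i)]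
  simp

end Pi

/-! ### Mutual information -/

section MutualInfo

variable {Ω 𝓧 𝓩 𝓧' 𝓩' : Type*} [MeasurableSpace Ω] [MeasurableSpace 𝓧] [MeasurableSpace 𝓩]
  [MeasurableSpace 𝓧'] [MeasurableSpace 𝓩'] {P : Measure Ω}

lemma mutualInfo_congr {X X' : Ω → 𝓧} {Z Z' : Ω → 𝓩} (hX : X =ᵐ[P] X') (hZ : Z =ᵐ[P] Z') :
    mutualInfo P X Z = mutualInfo P X' Z' := by
  have h : (fun ω => (X ω, Z ω)) =ᵐ[P] fun ω => (X' ω, Z' ω) := by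
    filter_upwards [hX, hZ] with ω h1 h2
    rw [h1, h2]
  rw [mutualInfo, mutualInfo, Measure.map_congr h, Measure.map_congr hX, Measure.map_congr hZ]

lemma mutualInfo_map {Ω' : Type*} [MeasurableSpace Ω'] {f : Ω → Ω'} (hf : Measurable f)
    {X : Ω' → 𝓧} {Z : Ω' → 𝓩} (hX : Measurable X) (hZ : Measurable Z) :
    mutualInfo (P.map f) X Z = mutualInfo P (fun ω => X (f ω)) (fun ω => Z (f ω)) := by
  rw [mutualInfo, mutualInfo, Measure.map_map (hX.prodMk hZ) hf, Measure.map_map hX hf,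
    Measure.map_map hZ hf]
  rfl

variable [IsProbabilityMeasure P]

lemma mutualInfo_comp_le {X : Ω → 𝓧} {Z : Ω → 𝓩} (hX : Measurable X) (hZ : Measurable Z)
    {f : 𝓧 → 𝓧'} {g : 𝓩 → 𝓩'} (hf : Measurable f) (hg : Measurable g) :
    mutualInfo P (fun ω => f (X ω)) (fun ω => g (Z ω)) ≤ mutualInfo P X Z := by
  have := Measure.isProbabilityMeasure_map (μ := P) hX.aemeasurable
  have := Measure.isProbabilityMeasure_map (μ := P) hZ.aemeasurable
  have h := klDiv_map_le (P.map fun ω => (X ω, Z ω)) ((P.map X).prod (P.map Z)) (hf.prodMap hg)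
  rw [← Measure.map_prod_map _ _ hf hg, Measure.map_map (hf.prodMap hg) (hX.prodMk hZ),
    Measure.map_map hf hX, Measure.map_map hg hZ] at h
  exact h

/-- Data processing in both directions, since injective recodings with measurable left inverses lose
nothing. -/
lemma mutualInfo_comp_of_leftInverse {X : Ω → 𝓧} {Z : Ω → 𝓩} (hX : Measurable X)
    (hZ : Measurable Z) {f : 𝓧 → 𝓧'} {f' : 𝓧' → 𝓧} {g : 𝓩 → 𝓩'} {g' : 𝓩' → 𝓩}
    (hf : Measurable f) (hf' : Measurable f') (hg : Measurable g) (hg' : Measurable g')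
    (hff : Function.LeftInverse f' f) (hgg : Function.LeftInverse g' g) :
    mutualInfo P (fun ω => f (X ω)) (fun ω => g (Z ω)) = mutualInfo P X Z := by
  refine le_antisymm (mutualInfo_comp_le hX hZ hf hg) ?_
  have h := mutualInfo_comp_le (P := P) (hf.comp hX) (hg.comp hZ) hf' hg'
  simp only [Function.comp_apply, hff _, hgg _] at h
  exact h

end MutualInfo

/-! ### Mutual information of vectors and of their coordinates -/

section Coordinates

variable {Ω : Type*} [MeasurableSpace Ω] {P : Measure Ω}
  {ι : Type*} [Fintype ι] {𝓧 𝓩 : Type*} [MeasurableSpace 𝓧] [MeasurableSpace 𝓩]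

/-- A version of the density of a joint law with respect to the product of its marginals has
conditional mass one. -/
lemma lintegral_rnDeriv_prod_left {μ : Measure (𝓧 × 𝓩)} [IsProbabilityMeasure μ]
    (hac : μ ≪ (μ.fst).prod μ.snd) :
    ∀ᵐ z ∂μ.snd, ∫⁻ x, μ.rnDeriv ((μ.fst).prod μ.snd) (x, z) ∂μ.fst = 1 := by
  set g := μ.rnDeriv ((μ.fst).prod μ.snd) with hg
  have hgm : Measurable g := Measure.measurable_rnDeriv _ _
  have hgm' : Measurable fun z => ∫⁻ x, g (x, z) ∂μ.fst := hgm.lintegral_prod_left'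
  refine ae_eq_of_forall_setLIntegral_eq_of_sigmaFinite hgm' measurable_const fun B hB _ => ?_
  have h1 : μ (Set.univ ×ˢ B) = ∫⁻ p in Set.univ ×ˢ B, g p ∂((μ.fst).prod μ.snd) :=
    (Measure.setLIntegral_rnDeriv hac _).symm
  rw [setLIntegral_prod_symm _ hgm.aemeasurable, Measure.restrict_univ] at h1
  rw [← h1, setLIntegral_const, one_mul, Measure.snd_apply hB, Set.univ_prod]

/-- Mutual information is superadditive if the components of the source are independent. -/
lemma sum_mutualInfo_le {X : ι → Ω → 𝓧} {Z : ι → Ω → 𝓩} (hX : ∀ i, Measurable (X i))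
    (hZ : ∀ i, Measurable (Z i)) (hind : iIndepFun X P) :
    ∑ i, mutualInfo P (X i) (Z i) ≤ mutualInfo P (fun ω i => X i ω) (fun ω i => Z i ω) := by
  have := hind.isProbabilityMeasure
  have hXm : Measurable fun ω i => X i ω := measurable_pi_lambda _ hX
  have hZm : Measurable fun ω i => Z i ω := measurable_pi_lambda _ hZ
  by_cases htop : mutualInfo P (fun ω i => X i ω) (fun ω i => Z i ω) = ⊤
  · simp [htop]
  set μ := P.map fun ω => ((fun i => X i ω), (fun i => Z i ω)) with hμ
  set ν := (P.map fun ω i => X i ω).prod (P.map fun ω i => Z i ω) with hν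
  have hpX := Measure.isProbabilityMeasure_map (μ := P) hXm.aemeasurable
  have hpZ := Measure.isProbabilityMeasure_map (μ := P) hZm.aemeasurable
  have hpμ : IsProbabilityMeasure μ :=
    Measure.isProbabilityMeasure_map (hXm.prodMk hZm).aemeasurable
  have hpi : ∀ i, IsProbabilityMeasure (P.map (X i)) := fun i =>
    Measure.isProbabilityMeasure_map (hX i).aemeasurable
  have hqi : ∀ i, IsProbabilityMeasure (P.map (Z i)) := fun i =>
    Measure.isProbabilityMeasure_map (hZ i).aemeasurable
  have hri : ∀ i, IsProbabilityMeasure (P.map fun ω => (X i ω, Z i ω)) := fun i =>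
    Measure.isProbabilityMeasure_map ((hX i).prodMk (hZ i)).aemeasurable
  -- By data processing each coordinate has finite information, so the pairwise densities and
  -- log-likelihood ratios exist and are integrable.
  have hle : ∀ i, mutualInfo P (X i) (Z i) ≤ klDiv μ ν := fun i =>
    mutualInfo_comp_le hXm hZm (measurable_pi_apply i) (measurable_pi_apply i)
  have hfin : ∀ i, klDiv (P.map fun ω => (X i ω, Z i ω)) ((P.map (X i)).prod (P.map (Z i))) ≠ ⊤ :=
    fun i => ne_top_of_le_ne_top htop (hle i)
  have hac : ∀ i, P.map (fun ω => (X i ω, Z i ω)) ≪ (P.map (X i)).prod (P.map (Z i)) := fun i =>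
    (klDiv_ne_top_iff.1 (hfin i)).1
  have hint : ∀ i, Integrable (llr (P.map fun ω => (X i ω, Z i ω))
      ((P.map (X i)).prod (P.map (Z i)))) (P.map fun ω => (X i ω, Z i ω)) := fun i =>
    (klDiv_ne_top_iff.1 (hfin i)).2
  set g : ι → 𝓧 × 𝓩 → ℝ≥0∞ := fun i =>
    (P.map fun ω => (X i ω, Z i ω)).rnDeriv ((P.map (X i)).prod (P.map (Z i))) with hg
  have hgm : ∀ i, Measurable (g i) := fun i => Measure.measurable_rnDeriv _ _
  have hg1 : ∀ i, ∀ᵐ z ∂(P.map (Z i)), ∫⁻ x, g i (x, z) ∂(P.map (X i)) = 1 := fun i => by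
    have h := lintegral_rnDeriv_prod_left (μ := P.map fun ω => (X i ω, Z i ω))
    rw [Measure.fst_map_prodMk (hZ i), Measure.snd_map_prodMk (hX i)] at h
    exact h (hac i)
  have hproj : ∀ i, Measurable fun p : (ι → 𝓧) × (ι → 𝓩) => (p.1 i, p.2 i) := fun i => by fun_prop
  have hGm : Measurable fun p : (ι → 𝓧) × (ι → 𝓩) => ∏ i, g i (p.1 i, p.2 i) :=
    Finset.measurable_fun_prod _ fun i _ => (hgm i).comp (hproj i)
  -- The product of the pairwise densities is the test density for Gibbs' inequality. For fixed z
  -- the integral over the independent source components factors into terms equal to one, so no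
  -- assumption on the joint law of the `Z i` is needed.
  have hG1 : ∫⁻ p, ∏ i, g i (p.1 i, p.2 i) ∂ν ≤ 1 := by
    rw [hν, lintegral_prod_symm _ hGm.aemeasurable]
    have h : ∀ᵐ z ∂(P.map fun ω i => Z i ω),
        ∫⁻ x, ∏ i, g i (x i, z i) ∂(P.map fun ω i => X i ω) = 1 := by
      have h' : ∀ᵐ z ∂(P.map fun ω i => Z i ω), ∀ i,
          ∫⁻ x, g i (x, z i) ∂(P.map (X i)) = 1 := by
        rw [ae_all_iff]
        intro i
        have hmp : MeasurePreserving (Function.eval i) (P.map fun ω i => Z i ω) (P.map (Z i)) :=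
          ⟨measurable_pi_apply i, Measure.map_map (measurable_pi_apply i) hZm⟩
        exact hmp.quasiMeasurePreserving.ae (hg1 i)
      filter_upwards [h'] with z hz
      rw [(iIndepFun_iff_map_fun_eq_pi_map fun i => (hX i).aemeasurable).1 hind,
        lintegral_pi_prod (fun i => P.map (X i)) (f := fun i x => g i (x, z i))
          fun i => (hgm i).comp measurable_prodMk_right]
      exact Finset.prod_eq_one fun i _ => hz i
    rw [lintegral_congr_ae h]
    simp
  have hmp : ∀ i, MeasurePreserving (fun p : (ι → 𝓧) × (ι → 𝓩) => (p.1 i, p.2 i)) μ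
      (P.map fun ω => (X i ω, Z i ω)) := fun i =>
    ⟨hproj i, Measure.map_map (hproj i) (hXm.prodMk hZm)⟩
  have hpos : ∀ᵐ p ∂μ, ∀ i, 0 < g i (p.1 i, p.2 i) ∧ g i (p.1 i, p.2 i) < ⊤ := by
    rw [ae_all_iff]
    intro i
    have h' : ∀ᵐ y ∂(P.map fun ω => (X i ω, Z i ω)), 0 < g i y ∧ g i y < ⊤ := by
      filter_upwards [Measure.rnDeriv_pos (hac i), (hac i).ae_le (Measure.rnDeriv_lt_top
        (P.map fun ω => (X i ω, Z i ω)) _)] with x h1 h2 using ⟨h1, h2⟩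
    exact (hmp i).quasiMeasurePreserving.ae h'
  have hlog : (fun p : (ι → 𝓧) × (ι → 𝓩) => Real.log (∏ i, g i (p.1 i, p.2 i)).toReal) =ᵐ[μ]
      fun p => ∑ i, llr (P.map fun ω => (X i ω, Z i ω)) ((P.map (X i)).prod (P.map (Z i)))
        (p.1 i, p.2 i) := by
    filter_upwards [hpos] with p hp
    rw [ENNReal.toReal_prod, Real.log_prod
      (fun i _ => (ENNReal.toReal_pos (hp i).1.ne' (hp i).2.ne).ne')]
    rfl
  have hinti : ∀ i, Integrable (fun p : (ι → 𝓧) × (ι → 𝓩) =>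
      llr (P.map fun ω => (X i ω, Z i ω)) ((P.map (X i)).prod (P.map (Z i))) (p.1 i, p.2 i)) μ :=
    fun i => (hmp i).integrable_comp_of_integrable (hint i)
  have hpos' : ∀ᵐ p ∂μ, ∏ i, g i (p.1 i, p.2 i) ≠ 0 := by
    filter_upwards [hpos] with p hp
    exact Finset.prod_ne_zero_iff.2 fun i _ => (hp i).1.ne'
  have hmain := integral_log_le_klDiv hGm hG1 hpos'
    ((integrable_congr hlog).2 (integrable_finsetSum _ fun i _ => hinti i))
  rw [integral_congr_ae hlog, integral_finsetSum _ fun i _ => hinti i] at hmain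
  refine le_trans (le_of_eq ?_) hmain
  have heq : ∀ i, ∫ p, llr (P.map fun ω => (X i ω, Z i ω)) ((P.map (X i)).prod (P.map (Z i)))
      (p.1 i, p.2 i) ∂μ = ∫ p, llr (P.map fun ω => (X i ω, Z i ω))
        ((P.map (X i)).prod (P.map (Z i))) p ∂(P.map fun ω => (X i ω, Z i ω)) := fun i => by
    rw [← (hmp i).map_eq, integral_map (hproj i).aemeasurable]
    rw [(hmp i).map_eq]
    exact (hint i).1
  simp_rw [heq]
  rw [ENNReal.ofReal_sum_of_nonneg fun i _ => by
    simpa using integral_llr_add_sub_measure_univ_nonneg (hac i) (hint i)]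
  refine Finset.sum_congr rfl fun i _ => ?_
  rw [mutualInfo, klDiv_of_ac_of_integrable (hac i) (hint i)]
  simp

/-- If the pairs are independent, both the joint law and the product of the marginals are product
measures up to regrouping of coordinates, so `klDiv_pi_le` applies after data processing. -/
lemma mutualInfo_le_sum {X : ι → Ω → 𝓧} {Z : ι → Ω → 𝓩} (hX : ∀ i, Measurable (X i))
    (hZ : ∀ i, Measurable (Z i)) (hind : iIndepFun (fun i ω => (X i ω, Z i ω)) P) :
    mutualInfo P (fun ω i => X i ω) (fun ω i => Z i ω) ≤ ∑ i, mutualInfo P (X i) (Z i) := by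
  have := hind.isProbabilityMeasure
  have hpi : ∀ i, IsProbabilityMeasure (P.map (X i)) := fun i =>
    Measure.isProbabilityMeasure_map (hX i).aemeasurable
  have hqi : ∀ i, IsProbabilityMeasure (P.map (Z i)) := fun i =>
    Measure.isProbabilityMeasure_map (hZ i).aemeasurable
  have hri : ∀ i, IsProbabilityMeasure (P.map fun ω => (X i ω, Z i ω)) := fun i =>
    Measure.isProbabilityMeasure_map ((hX i).prodMk (hZ i)).aemeasurable
  have hindX : iIndepFun X P := hind.comp (fun _ => Prod.fst) fun _ => measurable_fst
  have hindZ : iIndepFun Z P := hind.comp (fun _ => Prod.snd) fun _ => measurable_snd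
  refine le_trans ?_ (klDiv_pi_le (fun i => P.map fun ω => (X i ω, Z i ω))
    (fun i => (P.map (X i)).prod (P.map (Z i))))
  set e := MeasurableEquiv.arrowProdEquivProdArrow 𝓧 𝓩 ι
  have hmp := measurePreserving_arrowProdEquivProdArrow 𝓧 𝓩 ι (fun i => P.map (X i))
    (fun i => P.map (Z i))
  have h := klDiv_map_le (Measure.pi fun i => P.map fun ω => (X i ω, Z i ω))
    (Measure.pi fun i => (P.map (X i)).prod (P.map (Z i))) e.measurable
  rw [hmp.map_eq, ← (iIndepFun_iff_map_fun_eq_pi_map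
    fun i => ((hX i).prodMk (hZ i)).aemeasurable).1 hind,
    ← (iIndepFun_iff_map_fun_eq_pi_map fun i => (hX i).aemeasurable).1 hindX,
    ← (iIndepFun_iff_map_fun_eq_pi_map fun i => (hZ i).aemeasurable).1 hindZ,
    Measure.map_map e.measurable (by fun_prop)] at h
  rw [(iIndepFun_iff_map_fun_eq_pi_map
    fun i => ((hX i).prodMk (hZ i)).aemeasurable).1 hind] at h
  exact h

end Coordinates

/-! ### Conditional mutual information of translates -/

section Translate

variable {Ω 𝓨 E F : Type*} [MeasurableSpace Ω] [MeasurableSpace 𝓨]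
  [AddCommGroup E] [MeasurableSpace E] [MeasurableAdd₂ E]

/-- The translates of a law by a function of the conditioning variable. -/
noncomputable def translateKernel (μ : Measure E) {b : 𝓨 → E} (hb : Measurable b) : Kernel 𝓨 E :=
  (Kernel.const 𝓨 μ ×ₖ Kernel.deterministic b hb).map fun p => p.1 + p.2

instance (μ : Measure E) [IsProbabilityMeasure μ] {b : 𝓨 → E} (hb : Measurable b) :
    IsMarkovKernel (translateKernel μ hb) :=
  Kernel.IsMarkovKernel.map _ (by fun_prop)

lemma translateKernel_apply (μ : Measure E) [IsProbabilityMeasure μ] {b : 𝓨 → E}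
    (hb : Measurable b) (y : 𝓨) : translateKernel μ hb y = μ.map fun x => x + b y := by
  rw [translateKernel, Kernel.map_apply _ (by fun_prop), Kernel.prod_apply, Kernel.const_apply,
    Kernel.deterministic_apply, Measure.prod_dirac, Measure.map_map (by fun_prop) (by fun_prop)]
  rfl

lemma compProd_translateKernel (ρ : Measure 𝓨) [IsProbabilityMeasure ρ] (μ : Measure E)
    [IsProbabilityMeasure μ] {b : 𝓨 → E} (hb : Measurable b) :
    ρ ⊗ₘ translateKernel μ hb = (ρ.prod μ).map fun p => (p.1, p.2 + b p.1) := by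
  have hm : Measurable fun p : 𝓨 × E => (p.1, p.2 + b p.1) := by fun_prop
  ext s hs
  rw [Measure.compProd_apply hs, Measure.map_apply hm hs, Measure.prod_apply (hm hs)]
  refine lintegral_congr fun y => ?_
  rw [translateKernel_apply, Measure.map_apply (by fun_prop) (measurable_prodMk_left hs)]
  rfl

instance : MeasurableAdd₂ (E × E) :=
  ⟨(show Measurable fun p : (E × E) × E × E => (p.1.1 + p.2.1, p.1.2 + p.2.2) by fun_prop)⟩

lemma translateKernel_prod (μ ν : Measure E) [IsProbabilityMeasure μ] [IsProbabilityMeasure ν]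
    {b : 𝓨 → E} (hb : Measurable b) :
    translateKernel μ hb ×ₖ translateKernel ν hb =
      translateKernel (μ.prod ν) (hb.prodMk hb) := by
  ext1 y
  rw [Kernel.prod_apply, translateKernel_apply, translateKernel_apply, translateKernel_apply,
    Measure.map_prod_map _ _ (by fun_prop) (by fun_prop)]
  rfl

variable [MeasurableSub₂ E] {P : Measure Ω} [IsProbabilityMeasure P]
  {X Z : Ω → E} {Y : Ω → 𝓨} {b : 𝓨 → E}

/-- Given Y = y, the source is an independent variable shifted by b(y). Almost everywhere uniqueness
of disintegrations identifies the conditional law. -/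
lemma condDistrib_ae_eq_translateKernel [StandardBorelSpace E] [Nonempty E]
    (hX : Measurable X) (hY : Measurable Y) (hb : Measurable b)
    (hind : IndepFun Y (fun ω => X ω - b (Y ω)) P) :
    condDistrib X Y P =ᵐ[P.map Y] translateKernel (P.map fun ω => X ω - b (Y ω)) hb := by
  have hX' : Measurable fun ω => X ω - b (Y ω) := hX.sub (hb.comp hY)
  have := Measure.isProbabilityMeasure_map (μ := P) hX'.aemeasurable
  have := Measure.isProbabilityMeasure_map (μ := P) hY.aemeasurable
  refine condDistrib_ae_eq_of_measure_eq_compProd Y hX.aemeasurable ?_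
  rw [compProd_translateKernel, ← (indepFun_iff_map_prod_eq_prod_map_map hY.aemeasurable
    hX'.aemeasurable).1 hind, Measure.map_map (by fun_prop) (hY.prodMk hX')]
  congr 1
  funext ω
  simp

variable [StandardBorelSpace E] [Nonempty E]

/-- Data processing under (y, x, z) ↦ (x - b(y), z - b(y)). Only the source translate has to be
independent of Y: its conditional law is then free of y, and this alone turns the image of the
reference measure into a product. The reproduction may depend on Y in any way. -/
lemma mutualInfo_sub_le_condMutualInfo (hX : Measurable X) (hZ : Measurable Z) (hY : Measurable Y)
    (hb : Measurable b) (hind : IndepFun Y (fun ω => X ω - b (Y ω)) P) :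
    mutualInfo P (fun ω => X ω - b (Y ω)) (fun ω => Z ω - b (Y ω)) ≤ condMutualInfo P X Z Y := by
  have hX' : Measurable fun ω => X ω - b (Y ω) := hX.sub (hb.comp hY)
  have hZ' : Measurable fun ω => Z ω - b (Y ω) := hZ.sub (hb.comp hY)
  have := Measure.isProbabilityMeasure_map (μ := P) hX'.aemeasurable
  have := Measure.isProbabilityMeasure_map (μ := P) hZ'.aemeasurable
  have := Measure.isProbabilityMeasure_map (μ := P) hY.aemeasurable
  have := Measure.isProbabilityMeasure_map (μ := P) (hY.prodMk (hX.prodMk hZ)).aemeasurable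
  have hΦ : Measurable fun p : 𝓨 × E × E => (p.2.1 - b p.1, p.2.2 - b p.1) := by fun_prop
  have h := klDiv_map_le (P.map fun ω => (Y ω, (X ω, Z ω)))
    (P.map Y ⊗ₘ (condDistrib X Y P ×ₖ condDistrib Z Y P)) hΦ
  rw [Measure.map_map hΦ (hY.prodMk (hX.prodMk hZ))] at h
  refine le_trans (le_of_eq ?_) h
  rw [mutualInfo]
  congr 1
  refine Measure.prod_eq fun A B hA hB => ?_
  have hsB : MeasurableSet {p : 𝓨 × E | p.2 - b p.1 ∈ B} :=
    (show Measurable fun p : 𝓨 × E => p.2 - b p.1 by fun_prop) hB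
  rw [Measure.map_apply hΦ (hA.prod hB), Measure.compProd_apply (hΦ (hA.prod hB))]
  -- On a rectangle the source factor is constant in y and leaves the integral. The remaining factor
  -- averages the conditional laws of `Z` to the law of its translate.
  have h1 : ∀ᵐ y ∂(P.map Y), (condDistrib X Y P ×ₖ condDistrib Z Y P) y (Prod.mk y ⁻¹'
      ((fun p : 𝓨 × E × E => (p.2.1 - b p.1, p.2.2 - b p.1)) ⁻¹' A ×ˢ B)) =
      P.map (fun ω => X ω - b (Y ω)) A *
        condDistrib Z Y P y (Prod.mk y ⁻¹' {p : 𝓨 × E | p.2 - b p.1 ∈ B}) := by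
    filter_upwards [condDistrib_ae_eq_translateKernel hX hY hb hind] with y hy
    have hset : Prod.mk y ⁻¹' ((fun p : 𝓨 × E × E => (p.2.1 - b p.1, p.2.2 - b p.1)) ⁻¹' A ×ˢ B)
        = {x | x - b y ∈ A} ×ˢ (Prod.mk y ⁻¹' {p : 𝓨 × E | p.2 - b p.1 ∈ B}) := by
      ext p; rfl
    have hsA : MeasurableSet {x | x - b y ∈ A} :=
      (show Measurable fun x : E => x - b y by fun_prop) hA
    rw [hset, Kernel.prod_apply, Measure.prod_prod, hy, translateKernel_apply,
      Measure.map_apply (by fun_prop) hsA]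
    congr 2
    ext x
    simp
  rw [lintegral_congr_ae h1, lintegral_const_mul _
    (Kernel.measurable_kernel_prodMk_left hsB), ← Measure.compProd_apply hsB,
    compProd_map_condDistrib hZ.aemeasurable, Measure.map_apply (hY.prodMk hZ) hsB,
    Measure.map_apply hZ' hB]
  rfl

/-- If the translates are jointly independent of the side information, the conditional mutual
information is the mutual information of the translates. -/
lemma condMutualInfo_eq_mutualInfo_sub (hX : Measurable X) (hZ : Measurable Z) (hY : Measurable Y)
    (hb : Measurable b) (hind : IndepFun Y (fun ω => (X ω - b (Y ω), Z ω - b (Y ω))) P) :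
    condMutualInfo P X Z Y = mutualInfo P (fun ω => X ω - b (Y ω)) (fun ω => Z ω - b (Y ω)) := by
  have hX' : Measurable fun ω => X ω - b (Y ω) := hX.sub (hb.comp hY)
  have hZ' : Measurable fun ω => Z ω - b (Y ω) := hZ.sub (hb.comp hY)
  have hindX : IndepFun Y (fun ω => X ω - b (Y ω)) P := hind.comp measurable_id measurable_fst
  have hindZ : IndepFun Y (fun ω => Z ω - b (Y ω)) P := hind.comp measurable_id measurable_snd
  have := Measure.isProbabilityMeasure_map (μ := P) hX'.aemeasurable
  have := Measure.isProbabilityMeasure_map (μ := P) hZ'.aemeasurable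
  have := Measure.isProbabilityMeasure_map (μ := P) hY.aemeasurable
  have := Measure.isProbabilityMeasure_map (μ := P) (hX'.prodMk hZ').aemeasurable
  refine le_antisymm ?_ (mutualInfo_sub_le_condMutualInfo hX hZ hY hb hindX)
  -- The shift by (b, b) produces both the joint law and the reference law from products with the
  -- common factor P_Y. Data processing followed by `klDiv_prod_left` removes that factor.
  have hΨ : Measurable fun p : 𝓨 × E × E => (p.1, p.2 + (b p.1, b p.1)) := by fun_prop
  have hk : (condDistrib X Y P ×ₖ condDistrib Z Y P) =ᵐ[P.map Y]
      translateKernel ((P.map fun ω => X ω - b (Y ω)).prod (P.map fun ω => Z ω - b (Y ω)))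
        (hb.prodMk hb) := by
    filter_upwards [condDistrib_ae_eq_translateKernel hX hY hb hindX,
      condDistrib_ae_eq_translateKernel hZ hY hb hindZ] with y h1 h2
    rw [← translateKernel_prod, Kernel.prod_apply, Kernel.prod_apply, h1, h2]
  have hjoint : P.map (fun ω => (Y ω, (X ω, Z ω))) =
      ((P.map Y).prod (P.map fun ω => (X ω - b (Y ω), Z ω - b (Y ω)))).map
        fun p : 𝓨 × E × E => (p.1, p.2 + (b p.1, b p.1)) := by
    rw [← (indepFun_iff_map_prod_eq_prod_map_map hY.aemeasurable
      (hX'.prodMk hZ').aemeasurable).1 hind, Measure.map_map hΨ (hY.prodMk (hX'.prodMk hZ'))]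
    congr 1
    funext ω
    simp
  rw [condMutualInfo, Measure.compProd_congr hk, compProd_translateKernel, hjoint, mutualInfo]
  exact (klDiv_map_le _ _ hΨ).trans_eq (klDiv_prod_left _ _ _)

end Translate

/-! ### The scalar Gaussian source -/

section Scalar

open scoped NNReal

/-- The density of the backward channel `N(z, d)` with respect to the source law `N(0, l)`. -/
noncomputable def gaussianRatio (l d : ℝ≥0) (p : ℝ × ℝ) : ℝ≥0∞ :=
  gaussianPDF p.2 d p.1 / gaussianPDF 0 l p.1

lemma measurable_gaussianRatio (l d : ℝ≥0) : Measurable (gaussianRatio l d) := by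
  have h : Measurable fun p : ℝ × ℝ => gaussianPDF p.2 d p.1 :=
    measurable_uncurry_gaussianPDF.comp
      (measurable_snd.prodMk (measurable_const.prodMk measurable_fst))
  exact h.div ((measurable_gaussianPDF 0 l).comp measurable_fst)

variable {l d : ℝ≥0}

/-- Change of measure from N(0, l) to N(z, d). With F = 1 it shows that the ratio is a conditional
probability density for every z. -/
lemma lintegral_gaussianRatio_mul (hl : l ≠ 0) (hd : d ≠ 0) (z : ℝ) {F : ℝ → ℝ≥0∞}
    (hF : Measurable F) :
    ∫⁻ x, gaussianRatio l d (x, z) * F x ∂(gaussianReal 0 l) = ∫⁻ x, F x ∂(gaussianReal z d) := by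
  have hm : Measurable fun x => gaussianRatio l d (x, z) :=
    (measurable_gaussianRatio l d).comp measurable_prodMk_right
  rw [gaussianReal_of_var_ne_zero _ hl, gaussianReal_of_var_ne_zero _ hd,
    lintegral_withDensity_eq_lintegral_mul _ (measurable_gaussianPDF 0 l)
      (show Measurable fun x => gaussianRatio l d (x, z) * F x from hm.mul hF),
    lintegral_withDensity_eq_lintegral_mul _ (measurable_gaussianPDF z d) hF]
  refine lintegral_congr fun x => ?_
  simp only [Pi.mul_apply, gaussianRatio]
  rw [← mul_assoc, ENNReal.mul_div_cancel (gaussianPDF_pos 0 hl x).ne' gaussianPDF_ne_top]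

lemma gaussianRatio_ne_zero (hd : d ≠ 0) (p : ℝ × ℝ) : gaussianRatio l d p ≠ 0 :=
  (ENNReal.div_pos (gaussianPDF_pos _ hd _).ne' gaussianPDF_ne_top).ne'

lemma log_gaussianRatio (hl : l ≠ 0) (hd : d ≠ 0) (p : ℝ × ℝ) :
    Real.log (gaussianRatio l d p).toReal =
      1 / 2 * Real.log (l / d) + p.1 ^ 2 / (2 * l) - (p.1 - p.2) ^ 2 / (2 * d) := by
  have hl0 : (0 : ℝ) < l := NNReal.coe_pos.2 (pos_iff_ne_zero.2 hl)
  have hd0 : (0 : ℝ) < d := NNReal.coe_pos.2 (pos_iff_ne_zero.2 hd)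
  have hpi := Real.pi_pos
  have hlog : ∀ (m x : ℝ) (v : ℝ), 0 < v → Real.log ((Real.sqrt (2 * Real.pi * v))⁻¹ *
      Real.exp (-(x - m) ^ 2 / (2 * v))) =
        -(1 / 2) * (Real.log (2 * Real.pi) + Real.log v) - (x - m) ^ 2 / (2 * v) := by
    intro m x v hv
    rw [Real.log_mul (by positivity) (by positivity), Real.log_inv, Real.log_exp,
      Real.log_sqrt (by positivity), Real.log_mul (by positivity) hv.ne']
    ring
  rw [gaussianRatio, ENNReal.toReal_div, toReal_gaussianPDF, toReal_gaussianPDF,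
    Real.log_div (gaussianPDFReal_pos _ _ _ hd).ne' (gaussianPDFReal_pos _ _ _ hl).ne',
    gaussianPDFReal, gaussianPDFReal, hlog _ _ _ hd0, hlog _ _ _ hl0,
    Real.log_div hl0.ne' hd0.ne']
  ring

variable {Ω : Type*} [MeasurableSpace Ω] {P : Measure Ω} [IsProbabilityMeasure P] {X Z : Ω → ℝ}

lemma integrable_sq_of_map_eq_gaussianReal (hXm : Measurable X) (hX : P.map X = gaussianReal 0 l) :
    Integrable (fun ω => X ω ^ 2) P ∧ ∫ ω, X ω ^ 2 ∂P = l := by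
  have h2 : MemLp id 2 (P.map X) := hX ▸ memLp_id_gaussianReal 2
  have h2' : MemLp X 2 P := h2.comp_of_map hXm.aemeasurable
  refine ⟨h2'.integrable_sq, ?_⟩
  have hv : Var[X; P] = l := by
    have h := variance_map (X := id) (μ := P) (Y := X) aemeasurable_id hXm.aemeasurable
    rw [hX, variance_id_gaussianReal] at h
    exact h.symm
  have hm : ∫ ω, X ω ∂P = 0 := by
    have h := integral_map (μ := P) (f := id) hXm.aemeasurable (by fun_prop)
    rw [hX] at h
    simpa using h.symm
  rw [variance_eq_sub h2', hm] at hv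
  simpa using hv

/-- The Gibbs lower bound with the backward channel of variance `d`. -/
lemma gaussianRatio_le_mutualInfo (hXm : Measurable X) (hZm : Measurable Z)
    (hX : P.map X = gaussianReal 0 l) (hl : l ≠ 0) (hd : d ≠ 0)
    (hint : Integrable (fun ω => (X ω - Z ω) ^ 2) P) :
    ENNReal.ofReal (1 / 2 * Real.log (l / d) + 1 / 2 - (∫ ω, (X ω - Z ω) ^ 2 ∂P) / (2 * d)) ≤
      mutualInfo P X Z := by
  have := Measure.isProbabilityMeasure_map (μ := P) hXm.aemeasurable
  have := Measure.isProbabilityMeasure_map (μ := P) hZm.aemeasurable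
  have := Measure.isProbabilityMeasure_map (μ := P) (hXm.prodMk hZm).aemeasurable
  have hl0 : (0 : ℝ) < l := NNReal.coe_pos.2 (pos_iff_ne_zero.2 hl)
  obtain ⟨hX2, hXl⟩ := integrable_sq_of_map_eq_gaussianReal hXm hX
  have hg1 : ∫⁻ p, gaussianRatio l d p ∂((P.map X).prod (P.map Z)) ≤ 1 := by
    rw [lintegral_prod_symm _ (measurable_gaussianRatio l d).aemeasurable, hX]
    have h : ∀ z, ∫⁻ x, gaussianRatio l d (x, z) ∂(gaussianReal 0 l) = 1 := fun z => by
      simpa using lintegral_gaussianRatio_mul hl hd z (F := fun _ => 1) measurable_const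
    simp [h]
  have hlm : AEStronglyMeasurable (fun p => Real.log (gaussianRatio l d p).toReal)
      (P.map fun ω => (X ω, Z ω)) :=
    (measurable_gaussianRatio l d).ennreal_toReal.log.aestronglyMeasurable
  have hi1 : Integrable (fun ω => 1 / 2 * Real.log (l / d) + X ω ^ 2 / (2 * l)) P :=
    (integrable_const _).add (hX2.div_const _)
  have hi2 : Integrable (fun ω => (X ω - Z ω) ^ 2 / (2 * d)) P := hint.div_const _
  have hi : Integrable (fun p => Real.log (gaussianRatio l d p).toReal)
      (P.map fun ω => (X ω, Z ω)) := by
    rw [integrable_map_measure hlm (hXm.prodMk hZm).aemeasurable]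
    simp only [Function.comp_def, log_gaussianRatio hl hd]
    exact hi1.sub hi2
  have h := integral_log_le_klDiv (measurable_gaussianRatio l d) hg1
    (Filter.Eventually.of_forall (gaussianRatio_ne_zero hd)) hi
  rw [integral_map (hXm.prodMk hZm).aemeasurable hlm] at h
  simp only [log_gaussianRatio hl hd] at h
  rw [integral_sub hi1 hi2, integral_add (integrable_const _) (hX2.div_const _), integral_div,
    integral_div, hXl] at h
  refine le_trans (le_of_eq ?_) h
  congr 1
  -- Since E X² = l, the term E X² / (2l) contributes the constant 1/2.
  simp
  field_simp

/-- With Gaussian error independent of the reproduction, X given Z = z has law N(z, d). The joint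
law is then exactly the product of the marginals weighted by `gaussianRatio`, so Gibbs' bound
becomes an equality. -/
lemma mutualInfo_of_indepFun_sub (hXm : Measurable X) (hZm : Measurable Z)
    (hX : P.map X = gaussianReal 0 l) (hl : l ≠ 0) (hd : d ≠ 0)
    (hN : P.map (fun ω => X ω - Z ω) = gaussianReal 0 d)
    (hind : IndepFun (fun ω => X ω - Z ω) Z P) :
    mutualInfo P X Z = ENNReal.ofReal (1 / 2 * Real.log (l / d)) := by
  have hNm : Measurable fun ω => X ω - Z ω := hXm.sub hZm
  have := Measure.isProbabilityMeasure_map (μ := P) hXm.aemeasurable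
  have := Measure.isProbabilityMeasure_map (μ := P) hZm.aemeasurable
  have := Measure.isProbabilityMeasure_map (μ := P) (hXm.prodMk hZm).aemeasurable
  have hl0 : (0 : ℝ) < l := NNReal.coe_pos.2 (pos_iff_ne_zero.2 hl)
  have hd0 : (0 : ℝ) < d := NNReal.coe_pos.2 (pos_iff_ne_zero.2 hd)
  obtain ⟨hX2, hXl⟩ := integrable_sq_of_map_eq_gaussianReal hXm hX
  obtain ⟨hN2, hNd⟩ := integrable_sq_of_map_eq_gaussianReal hNm hN
  have hlaw : P.map (fun ω => (X ω, Z ω)) =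
      ((P.map X).prod (P.map Z)).withDensity (gaussianRatio l d) := by
    refine Measure.ext_of_lintegral _ fun F hF => ?_
    have h1 : P.map (fun ω => (X ω, Z ω)) =
        ((gaussianReal 0 d).prod (P.map Z)).map fun p : ℝ × ℝ => (p.1 + p.2, p.2) := by
      rw [← hN, ← (indepFun_iff_map_prod_eq_prod_map_map hNm.aemeasurable hZm.aemeasurable).1 hind,
        Measure.map_map (by fun_prop) (hNm.prodMk hZm)]
      congr 1
      funext ω
      simp
    have h2 : Measurable fun p : ℝ × ℝ => F (p.1 + p.2, p.2) := hF.comp (by fun_prop)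
    rw [h1, lintegral_map hF (by fun_prop), lintegral_prod_symm _ h2.aemeasurable,
      lintegral_withDensity_eq_lintegral_mul _ (measurable_gaussianRatio l d) hF,
      lintegral_prod_symm _ ((measurable_gaussianRatio l d).mul hF).aemeasurable, hX]
    refine lintegral_congr fun z => ?_
    have h3 : Measurable fun x => F (x, z) := hF.comp measurable_prodMk_right
    simp only [Pi.mul_apply]
    rw [lintegral_gaussianRatio_mul hl hd z h3]
    have h4 : gaussianReal z d = (gaussianReal 0 d).map (· + z) := by
      rw [gaussianReal_map_add_const, zero_add]
    rw [h4, lintegral_map h3 (by fun_prop)]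
  have hlm : AEStronglyMeasurable (fun p => Real.log (gaussianRatio l d p).toReal)
      (P.map fun ω => (X ω, Z ω)) :=
    (measurable_gaussianRatio l d).ennreal_toReal.log.aestronglyMeasurable
  have hi1 : Integrable (fun ω => 1 / 2 * Real.log (l / d) + X ω ^ 2 / (2 * l)) P :=
    (integrable_const _).add (hX2.div_const _)
  have hi2 : Integrable (fun ω => (X ω - Z ω) ^ 2 / (2 * d)) P := hN2.div_const _
  have hi : Integrable (fun p => Real.log (gaussianRatio l d p).toReal)
      (P.map fun ω => (X ω, Z ω)) := by
    rw [integrable_map_measure hlm (hXm.prodMk hZm).aemeasurable]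
    simp only [Function.comp_def, log_gaussianRatio hl hd]
    exact hi1.sub hi2
  rw [mutualInfo, klDiv_withDensity (measurable_gaussianRatio l d) hlaw hi,
    integral_map (hXm.prodMk hZm).aemeasurable hlm]
  simp only [log_gaussianRatio hl hd]
  rw [integral_sub hi1 hi2, integral_add (integrable_const _) (hX2.div_const _), integral_div,
    integral_div, hXl, hNd]
  congr 1
  simp
  field_simp
  ring

/-- The scalar rate distortion bound. -/
lemma scalarRate_le_mutualInfo (hXm : Measurable X) (hZm : Measurable Z)
    (hX : P.map X = gaussianReal 0 l) (hl : l ≠ 0)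
    (hint : Integrable (fun ω => (X ω - Z ω) ^ 2) P) :
    scalarRate l (∫ ω, (X ω - Z ω) ^ 2 ∂P) ≤ mutualInfo P X Z := by
  have hl0 : (0 : ℝ) < l := NNReal.coe_pos.2 (pos_iff_ne_zero.2 hl)
  have hD : 0 ≤ ∫ ω, (X ω - Z ω) ^ 2 ∂P := integral_nonneg fun ω => sq_nonneg _
  rw [scalarRate]
  split_ifs with h0
  · rw [top_le_iff]
    refine ENNReal.eq_top_of_forall_nnreal_le fun c => ?_
    -- At zero distortion every backward variance is allowed. This choice makes ½ log(l/δ) equal to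
    -- c, so the information exceeds every finite bound.
    obtain ⟨δ, hδ⟩ : ∃ δ : ℝ≥0, (δ : ℝ) = l * Real.exp (-(2 * c)) :=
      ⟨_, Real.coe_toNNReal _ (by positivity)⟩
    have hδ0 : (δ : ℝ) ≠ 0 := by rw [hδ]; positivity
    refine le_trans ?_ (gaussianRatio_le_mutualInfo hXm hZm hX hl
      (d := δ) (fun h => hδ0 (by simp [h])) hint)
    rw [h0, ← ENNReal.ofReal_coe_nnreal]
    refine ENNReal.ofReal_le_ofReal ?_
    have h1 : (l : ℝ) / δ = Real.exp (2 * c) := by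
      rw [hδ, Real.exp_neg]
      field_simp
    rw [h1, Real.log_exp]
    simp
  · have hD0 : 0 < ∫ ω, (X ω - Z ω) ^ 2 ∂P := lt_of_le_of_ne hD (Ne.symm h0)
    rcases le_total ((l : ℝ) / ∫ ω, (X ω - Z ω) ^ 2 ∂P) 1 with h1 | h1
    · simp [max_eq_left h1]
    -- The best backward variance is the distortion itself, for which the two constant terms ½
    -- cancel.
    · obtain ⟨δ, hδ⟩ : ∃ δ : ℝ≥0, (δ : ℝ) = ∫ ω, (X ω - Z ω) ^ 2 ∂P :=
        ⟨_, Real.coe_toNNReal _ hD⟩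
      rw [← hδ] at h0 h1 ⊢
      have h := gaussianRatio_le_mutualInfo hXm hZm hX hl
        (d := δ) (fun h => h0 (by simp [h])) hint
      refine le_trans (le_of_eq ?_) h
      rw [max_eq_right h1, ← hδ]
      congr 1
      field_simp
      ring

end Scalar

/-! ### Linear algebra -/

section LinearAlgebra

open Matrix

variable {ι : Type*} [Fintype ι] [DecidableEq ι]

/-- Each eigenvalue satisfies x ≤ exp(x - 1); multiply over the spectrum. -/
lemma det_le_exp_trace {N : Matrix ι ι ℝ} (hN : N.PosSemidef) :
    N.det ≤ Real.exp (N.trace - Fintype.card ι) := by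
  rw [hN.isHermitian.det_eq_prod_eigenvalues, hN.isHermitian.trace_eq_sum_eigenvalues]
  have h : ((∑ i, hN.isHermitian.eigenvalues i : ℝ) - Fintype.card ι) =
      ∑ i, (hN.isHermitian.eigenvalues i - 1) := by
    simp [Finset.sum_sub_distrib]
  simp only [RCLike.ofReal_real_eq_id, id_eq]
  rw [h, Real.exp_sum]
  refine Finset.prod_le_prod (fun i _ => hN.eigenvalues_nonneg i) fun i _ => ?_
  have := Real.add_one_le_exp (hN.isHermitian.eigenvalues i - 1)
  linarith

/-- Hadamard's determinant inequality. -/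
lemma det_le_prod_diag {S : Matrix ι ι ℝ} (hS : S.PosDef) : S.det ≤ ∏ i, S i i := by
  have hd : ∀ i, 0 < S i i := fun i => hS.diag_pos
  -- Scaling to unit diagonal makes the trace equal to the dimension, so `det_le_exp_trace` bounds
  -- the scaled determinant by one.
  set r : ι → ℝ := fun i => (Real.sqrt (S i i))⁻¹ with hr
  have hr2 : ∀ i, r i * r i = (S i i)⁻¹ := fun i => by
    rw [hr, ← mul_inv, Real.mul_self_sqrt (hd i).le]
  have hN : (diagonal r * S * diagonal r).PosSemidef := by
    have h := hS.posSemidef.mul_mul_conjTranspose_same (diagonal r)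
    simpa [diagonal_conjTranspose] using h
  have h := det_le_exp_trace hN
  have htr : (diagonal r * S * diagonal r).trace = Fintype.card ι := by
    simp only [trace, diag_apply, mul_diagonal, diagonal_mul]
    rw [Finset.sum_congr rfl fun i _ => show r i * S i i * r i = 1 by
      rw [mul_right_comm, hr2, inv_mul_cancel₀ (hd i).ne']]
    simp
  rw [htr, sub_self, Real.exp_zero, det_mul, det_mul, det_diagonal, mul_right_comm,
    ← Finset.prod_mul_distrib, Finset.prod_congr rfl fun i _ => hr2 i, Finset.prod_inv_distrib,
    inv_mul_le_iff₀ (Finset.prod_pos fun i _ => hd i), mul_one] at h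
  exact h

/-- A symmetric matrix that commutes with a diagonal matrix is diagonalized by an orthogonal matrix
that commutes with it as well. -/
lemma exists_orthogonal_of_commute_diagonal {M : Matrix ι ι ℝ} (hM : M.IsHermitian) {lam : ι → ℝ}
    (hc : diagonal lam * M = M * diagonal lam) :
    ∃ (V : Matrix ι ι ℝ) (del : ι → ℝ), V * Vᵀ = 1 ∧ Vᵀ * V = 1 ∧
      diagonal lam * V = V * diagonal lam ∧ M = V * diagonal del * Vᵀ := by
  classical
  -- Indices are grouped by the value of `lam`. Commutation kills the entries of `M` between
  -- different groups, so `M` is block diagonal and the spectral theorem applies to each block.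
  set f := Set.rangeFactorization lam
  set e := Equiv.sigmaFiberEquiv f
  have hlam : ∀ p, lam (e p) = p.1 := fun p => congrArg Subtype.val p.2.2
  have hoff : ∀ i j, lam i ≠ lam j → M i j = 0 := fun i j hij => by
    have h := congrFun (congrFun hc i) j
    rw [diagonal_mul, mul_diagonal] at h
    have h' : (lam i - lam j) * M i j = 0 := by linarith
    exact (mul_eq_zero.1 h').resolve_left (sub_ne_zero.2 hij)
  set Mb : ∀ a : Set.range lam, Matrix {i // f i = a} {i // f i = a} ℝ :=
    fun a => M.submatrix Subtype.val Subtype.val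
  have hMb : ∀ a, (Mb a).IsHermitian := fun a => hM.submatrix _
  have hMe : M.submatrix e e = blockDiagonal' Mb := by
    ext ⟨a, i⟩ ⟨b, j⟩
    by_cases hab : a = b
    · subst hab
      rw [blockDiagonal'_apply_eq]
      rfl
    · rw [blockDiagonal'_apply_ne _ _ _ hab, submatrix_apply]
      refine hoff _ _ ?_
      rw [hlam, hlam]
      exact fun h => hab (Subtype.ext h)
  have hLe : (diagonal lam).submatrix e e =
      blockDiagonal' fun a : Set.range lam => (diagonal fun _ : {i // f i = a} => (a : ℝ)) := by
    rw [submatrix_diagonal_equiv, blockDiagonal'_diagonal]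
    congr 1
    funext p
    exact hlam p
  set Vb : ∀ a : Set.range lam, Matrix {i // f i = a} {i // f i = a} ℝ :=
    fun a => ((hMb a).eigenvectorUnitary : Matrix _ _ ℝ)
  have hVV : ∀ a, Vb a * (Vb a)ᵀ = 1 := fun a => by
    have h := Unitary.coe_mul_star_self (hMb a).eigenvectorUnitary
    rwa [Unitary.coe_star, star_eq_conjTranspose, conjTranspose_eq_transpose_of_trivial] at h
  have hVV' : ∀ a, (Vb a)ᵀ * Vb a = 1 := fun a => by
    have h := Unitary.coe_star_mul_self (hMb a).eigenvectorUnitary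
    rwa [star_eq_conjTranspose, conjTranspose_eq_transpose_of_trivial] at h
  have hspec : ∀ a, Mb a = Vb a * diagonal (hMb a).eigenvalues * (Vb a)ᵀ := fun a => by
    have h := (hMb a).spectral_theorem
    rw [Unitary.conjStarAlgAut_apply, star_eq_conjTranspose,
      conjTranspose_eq_transpose_of_trivial] at h
    exact h
  have hback : ∀ A : Matrix ι ι ℝ, A = (A.submatrix e e).submatrix e.symm e.symm := fun A => by
    ext i j
    simp
  refine ⟨(blockDiagonal' Vb).submatrix e.symm e.symm,
    fun i => (hMb (e.symm i).1).eigenvalues (e.symm i).2, ?_, ?_, ?_, ?_⟩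
  · rw [transpose_submatrix, submatrix_mul_equiv, blockDiagonal'_transpose, ← blockDiagonal'_mul]
    simp only [hVV]
    rw [← Pi.one_def, blockDiagonal'_one, submatrix_one_equiv]
  · rw [transpose_submatrix, submatrix_mul_equiv, blockDiagonal'_transpose, ← blockDiagonal'_mul]
    simp only [hVV']
    rw [← Pi.one_def, blockDiagonal'_one, submatrix_one_equiv]
  -- On each block `diagonal lam` is a scalar matrix, which commutes with any choice of
  -- eigenvectors.
  · rw [hback (diagonal lam), hLe, submatrix_mul_equiv, submatrix_mul_equiv, ← blockDiagonal'_mul,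
      ← blockDiagonal'_mul]
    congr 2
    funext a
    rw [← smul_one_eq_diagonal]
    simp
  · have hdel : (diagonal fun i => (hMb (e.symm i).1).eigenvalues (e.symm i).2) =
        (blockDiagonal' fun a => diagonal (hMb a).eigenvalues).submatrix e.symm e.symm := by
      rw [blockDiagonal'_diagonal, submatrix_diagonal_equiv]
      rfl
    rw [hdel, transpose_submatrix, submatrix_mul_equiv, submatrix_mul_equiv,
      blockDiagonal'_transpose, ← blockDiagonal'_mul, ← blockDiagonal'_mul, hback M, hMe]
    congr 2
    funext a
    exact hspec a

/-! ### Orthogonal conjugation and the rates of diagonal error covariances -/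

section Conj

variable {n : ℕ} {U S : Matrix (Fin n) (Fin n) ℝ} {lam del : Fin n → ℝ}

lemma transpose_mul_conj_mul (hU' : Uᵀ * U = 1) (A : Matrix (Fin n) (Fin n) ℝ) :
    Uᵀ * (U * A * Uᵀ) * U = A := by
  calc Uᵀ * (U * A * Uᵀ) * U = (Uᵀ * U) * A * (Uᵀ * U) := by simp only [Matrix.mul_assoc]
    _ = A := by rw [hU', Matrix.one_mul, Matrix.mul_one]

lemma conj_transpose_mul_mul (hU : U * Uᵀ = 1) (A : Matrix (Fin n) (Fin n) ℝ) :
    U * (Uᵀ * A * U) * Uᵀ = A := by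
  calc U * (Uᵀ * A * U) * Uᵀ = (U * Uᵀ) * A * (U * Uᵀ) := by simp only [Matrix.mul_assoc]
    _ = A := by rw [hU, Matrix.one_mul, Matrix.mul_one]

lemma conj_mul_conj (hU' : Uᵀ * U = 1) (A B : Matrix (Fin n) (Fin n) ℝ) :
    (U * A * Uᵀ) * (U * B * Uᵀ) = U * (A * B) * Uᵀ := by
  calc (U * A * Uᵀ) * (U * B * Uᵀ) = U * A * (Uᵀ * U) * (B * Uᵀ) := by
        simp only [Matrix.mul_assoc]
    _ = U * (A * B) * Uᵀ := by rw [hU', Matrix.mul_one]; simp only [Matrix.mul_assoc]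

lemma posSemidef_conj_diagonal_iff (hU' : Uᵀ * U = 1) :
    (U * diagonal del * Uᵀ).PosSemidef ↔ ∀ i, 0 ≤ del i := by
  constructor
  · intro h
    have h' := h.conjTranspose_mul_mul_same U
    rw [conjTranspose_eq_transpose_of_trivial, transpose_mul_conj_mul hU'] at h'
    exact posSemidef_diagonal_iff.1 h'
  · intro h
    have h' := (posSemidef_diagonal_iff.2 h).mul_mul_conjTranspose_same U
    rwa [conjTranspose_eq_transpose_of_trivial] at h'

lemma conj_diagonal_sub : U * diagonal lam * Uᵀ - U * diagonal del * Uᵀ =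
    U * diagonal (fun i => lam i - del i) * Uᵀ := by
  rw [← Matrix.sub_mul, ← Matrix.mul_sub, diagonal_sub]

lemma mem_errorCovs_conj_iff (hU' : Uᵀ * U = 1) :
    U * diagonal del * Uᵀ ∈ errorCovs (U * diagonal lam * Uᵀ) ↔
      ∀ i, 0 ≤ del i ∧ del i ≤ lam i := by
  rw [errorCovs, Set.mem_ofPred_eq, posSemidef_conj_diagonal_iff hU', conj_diagonal_sub,
    posSemidef_conj_diagonal_iff hU', ← forall_and]
  simp only [sub_nonneg]

lemma diag_transpose_mul_mul_mem_Icc {Q : Matrix (Fin n) (Fin n) ℝ} (hU' : Uᵀ * U = 1)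
    (hQ : Q = U * diagonal lam * Uᵀ) (hS : S ∈ errorCovs Q) (i : Fin n) :
    0 ≤ (Uᵀ * S * U) i i ∧ (Uᵀ * S * U) i i ≤ lam i := by
  have h1 := hS.1.conjTranspose_mul_mul_same U
  have h2 := hS.2.conjTranspose_mul_mul_same U
  rw [conjTranspose_eq_transpose_of_trivial] at h1 h2
  rw [Matrix.mul_sub, Matrix.sub_mul, hQ, transpose_mul_conj_mul hU'] at h2
  have h3 := h2.diag_nonneg (i := i)
  rw [Matrix.sub_apply, diagonal_apply_eq, sub_nonneg] at h3
  exact ⟨h1.diag_nonneg, h3⟩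

lemma trace_transpose_mul_mul (hU : U * Uᵀ = 1) : (Uᵀ * S * U).trace = S.trace := by
  rw [trace_mul_cycle, hU, Matrix.one_mul]

lemma pos_of_posDef_conj (hU' : Uᵀ * U = 1) (h : (U * diagonal lam * Uᵀ).PosDef) (i : Fin n) :
    0 < lam i := by
  have hinj : Function.Injective U.mulVec := fun x y hxy => by
    have := congrArg (Uᵀ *ᵥ ·) hxy
    simpa [mulVec_mulVec, hU'] using this
  have h' := h.conjTranspose_mul_mul_same hinj
  rw [conjTranspose_eq_transpose_of_trivial, transpose_mul_conj_mul hU'] at h'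
  exact posDef_diagonal_iff.1 h' i

lemma det_conj (hU : U * Uᵀ = 1) (A : Matrix (Fin n) (Fin n) ℝ) :
    (U * A * Uᵀ).det = A.det := by
  have h : U.det * Uᵀ.det = 1 := by rw [← det_mul, hU, det_one]
  rw [det_mul, det_mul, mul_right_comm, h, one_mul]

lemma inv_conj_diagonal (hU : U * Uᵀ = 1) (hU' : Uᵀ * U = 1) (hlam : ∀ i, lam i ≠ 0) :
    (U * diagonal lam * Uᵀ)⁻¹ = U * diagonal (fun i => (lam i)⁻¹) * Uᵀ := by
  refine inv_eq_right_inv ?_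
  rw [conj_mul_conj hU', diagonal_mul_diagonal]
  simp only [mul_inv_cancel₀ (hlam _)]
  rw [diagonal_one, Matrix.mul_one, hU]

/-- In a common eigenbasis the gain has eigenvalues 1 - δ_i/λ_i, nonnegative because δ_i ≤ λ_i. -/
lemma posSemidef_gain (hU : U * Uᵀ = 1) (hU' : Uᵀ * U = 1) (hlam : ∀ i, 0 < lam i)
    (h : U * diagonal del * Uᵀ ∈ errorCovs (U * diagonal lam * Uᵀ)) :
    (gain (U * diagonal lam * Uᵀ) (U * diagonal del * Uᵀ)).PosSemidef := by
  have hH : gain (U * diagonal lam * Uᵀ) (U * diagonal del * Uᵀ) =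
      U * diagonal (fun i => 1 - del i / lam i) * Uᵀ := by
    rw [gain, inv_conj_diagonal hU hU' fun i => (hlam i).ne', conj_mul_conj hU',
      diagonal_mul_diagonal]
    have h1 : (1 : Matrix (Fin n) (Fin n) ℝ) = U * diagonal (fun _ => 1) * Uᵀ := by
      rw [diagonal_one, Matrix.mul_one, hU]
    conv_lhs => rw [h1]
    exact conj_diagonal_sub
  rw [hH, posSemidef_conj_diagonal_iff hU']
  intro i
  rw [sub_nonneg, div_le_one (hlam i)]
  exact ((mem_errorCovs_conj_iff hU').1 h i).2

lemma scalarRate_of_le {l d : ℝ} (hd : 0 < d) (hdl : d ≤ l) :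
    scalarRate l d = ENNReal.ofReal (1 / 2 * Real.log (l / d)) := by
  rw [scalarRate, if_neg hd.ne', max_eq_right ((one_le_div hd).2 hdl)]

/-- Distortion beyond the variance buys nothing, as the rate is already zero at d = l. This lets an
arbitrary allocation be capped so that it satisfies S ≼ Q. -/
lemma scalarRate_min {l d : ℝ} (hl : 0 < l) :
    scalarRate l (min d l) = scalarRate l d := by
  rcases le_total d l with h | h
  · rw [min_eq_left h]
  · rw [min_eq_right h, scalarRate, scalarRate, if_neg hl.ne', if_neg (hl.trans_le h).ne',
      div_self hl.ne', max_self, max_eq_left ((div_le_one (hl.trans_le h)).2 h)]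

lemma sum_scalarRate_of_le (hd : ∀ i, 0 < del i ∧ del i ≤ lam i) :
    ∑ i, scalarRate (lam i) (del i) =
      ENNReal.ofReal (1 / 2 * Real.log (∏ i, lam i / del i)) := by
  rw [Real.log_prod fun i _ => (div_pos ((hd i).1.trans_le (hd i).2) (hd i).1).ne',
    Finset.mul_sum, ENNReal.ofReal_sum_of_nonneg]
  · exact Finset.sum_congr rfl fun i _ => scalarRate_of_le (hd i).1 (hd i).2
  · intro i _
    have := Real.log_nonneg ((one_le_div (hd i).1).2 (hd i).2)
    positivity

lemma detRate_conj (hU : U * Uᵀ = 1) (hU' : Uᵀ * U = 1)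
    (hd : ∀ i, 0 ≤ del i ∧ del i ≤ lam i) :
    detRate (U * diagonal lam * Uᵀ) (U * diagonal del * Uᵀ) =
      ∑ i, scalarRate (lam i) (del i) := by
  rw [detRate, det_conj hU, det_diagonal]
  split_ifs with h0
  · obtain ⟨i, -, hi⟩ := Finset.prod_eq_zero_iff.1 h0
    symm
    rw [ENNReal.sum_eq_top]
    exact ⟨i, Finset.mem_univ i, by rw [scalarRate, if_pos hi]⟩
  · have hpos : ∀ i, 0 < del i := fun i =>
      lt_of_le_of_ne (hd i).1 (Ne.symm (Finset.prod_ne_zero_iff.1 h0 i (Finset.mem_univ i)))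
    rw [inv_conj_diagonal hU hU' fun i => (hpos i).ne', conj_mul_conj hU', diagonal_mul_diagonal,
      det_conj hU, det_diagonal, sum_scalarRate_of_le fun i => ⟨hpos i, (hd i).2⟩]
    simp only [← div_eq_mul_inv]
    rw [max_eq_right (Finset.one_le_prod fun i _ => (one_le_div (hpos i)).2 (hd i).2)]

/-- Hadamard's inequality bounds the determinant rate by the rates of the diagonal. -/
lemma sum_scalarRate_le_detRate {Q : Matrix (Fin n) (Fin n) ℝ} (hU : U * Uᵀ = 1)
    (hU' : Uᵀ * U = 1) (hlam : ∀ i, 0 < lam i) (hQ : Q = U * diagonal lam * Uᵀ)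
    (hS : S ∈ errorCovs Q) :
    ∑ i, scalarRate (lam i) ((Uᵀ * S * U) i i) ≤ detRate Q S := by
  rw [detRate]
  split_ifs with h0
  · exact le_top
  have hM : (Uᵀ * S * U).PosSemidef := by
    have h := hS.1.conjTranspose_mul_mul_same U
    rwa [conjTranspose_eq_transpose_of_trivial] at h
  have hdet : (Uᵀ * S * U).det = S.det := by
    have h := det_conj (U := Uᵀ) (by rwa [transpose_transpose]) S
    rwa [transpose_transpose] at h
  -- A nonsingular positive semidefinite matrix is positive definite, as Hadamard's inequality
  -- requires here.
  have hM' : (Uᵀ * S * U).PosDef := by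
    rw [hM.posDef_iff_isUnit, isUnit_iff_isUnit_det, hdet, isUnit_iff_ne_zero]
    exact h0
  have hd : ∀ i, 0 < (Uᵀ * S * U) i i ∧ (Uᵀ * S * U) i i ≤ lam i := fun i =>
    ⟨hM'.diag_pos, (diag_transpose_mul_mul_mem_Icc hU' hQ hS i).2⟩
  have hS0 : 0 < S.det := hdet ▸ hM'.det_pos
  rw [sum_scalarRate_of_le hd]
  refine ENNReal.ofReal_le_ofReal (mul_le_mul_of_nonneg_left ?_ (by norm_num))
  refine Real.log_le_log (Finset.prod_pos fun i _ => div_pos (hlam i) (hd i).1) ?_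
  refine le_trans ?_ (le_max_right _ _)
  rw [det_mul, hQ, det_conj hU, det_diagonal, det_nonsing_inv, Ring.inverse_eq_inv',
    Finset.prod_div_distrib, div_eq_mul_inv]
  refine mul_le_mul_of_nonneg_left ?_ (Finset.prod_nonneg fun i _ => (hlam i).le)
  exact inv_anti₀ hS0 (hdet ▸ det_le_prod_diag hM')

end Conj

/-! ### Covariance identities for the source and for the channel noise -/

section Covariances

variable {nx ny : ℕ} {QX : Matrix (Fin nx) (Fin nx) ℝ} {C : Matrix (Fin ny) (Fin nx) ℝ}
  {D : Matrix (Fin ny) (Fin ny) ℝ}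

lemma posDef_sideCov (hQX : QX.PosDef) (hD : (D * Dᵀ).PosDef) : (sideCov QX C D).PosDef := by
  have h := hQX.posSemidef.mul_mul_conjTranspose_same C
  rw [conjTranspose_eq_transpose_of_trivial] at h
  exact PosDef.posSemidef_add h hD

lemma regression_mul_sideCov (hQX : QX.PosDef) (hD : (D * Dᵀ).PosDef) :
    regression QX C D * sideCov QX C D = QX * Cᵀ := by
  rw [regression, Matrix.mul_assoc, nonsing_inv_mul _
    ((isUnit_iff_isUnit_det _).1 (posDef_sideCov hQX hD).isUnit), Matrix.mul_one, crossCov]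

lemma condCov_eq (hQX : QX.PosDef) :
    condCov QX C D = QX - regression QX C D * (C * QX) := by
  have hs : QXᵀ = QX := by
    have := hQX.isHermitian.eq
    rwa [conjTranspose_eq_transpose_of_trivial] at this
  rw [condCov, regression, crossCov, transpose_mul, transpose_transpose, hs]

/-- This is the covariance of X - BY = (I - BC)X - BDV. It follows from the normal equation B Q_Y =
Q_X Cᵀ and displays Q as a sum of two positive semidefinite terms. -/
lemma condCov_eq_add (hQX : QX.PosDef) (hD : (D * Dᵀ).PosDef) :
    condCov QX C D = (1 - regression QX C D * C) * QX * (1 - regression QX C D * C)ᵀ +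
      regression QX C D * (D * Dᵀ) * (regression QX C D)ᵀ := by
  have h := congrArg (· * (regression QX C D)ᵀ) (regression_mul_sideCov (C := C) hQX hD)
  simp only [sideCov, Matrix.mul_add, Matrix.add_mul] at h
  rw [condCov_eq hQX]
  simp only [transpose_sub, transpose_mul, transpose_one, Matrix.sub_mul, Matrix.mul_sub,
    Matrix.one_mul, Matrix.mul_one, Matrix.mul_assoc] at h ⊢
  rw [eq_sub_of_add_eq' h]
  abel

/-- In the quadratic form of `condCov_eq_add`, the noise term is positive unless Bᵀx = 0. In that
case (I - BC)ᵀx = x, and the other term is xᵀ Q_X x > 0. -/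
lemma posDef_condCov (hQX : QX.PosDef) (hD : (D * Dᵀ).PosDef) : (condCov QX C D).PosDef := by
  set B := regression QX C D with hB
  have h1 := hQX.posSemidef.mul_mul_conjTranspose_same (1 - B * C)
  have h2 := hD.posSemidef.mul_mul_conjTranspose_same B
  rw [conjTranspose_eq_transpose_of_trivial] at h1 h2
  have hquad : ∀ {k m : ℕ} (A : Matrix (Fin k) (Fin m) ℝ) (M : Matrix (Fin m) (Fin m) ℝ)
      (x : Fin k → ℝ), x ⬝ᵥ ((A * M * Aᵀ) *ᵥ x) = (Aᵀ *ᵥ x) ⬝ᵥ (M *ᵥ (Aᵀ *ᵥ x)) := by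
    intro k m A M x
    rw [← mulVec_mulVec, ← mulVec_mulVec, dotProduct_mulVec, ← mulVec_transpose]
  rw [condCov_eq_add hQX hD]
  refine PosDef.of_dotProduct_mulVec_pos (h1.add h2).isHermitian fun x hx => ?_
  rw [star_trivial, add_mulVec, dotProduct_add, hquad, hquad]
  have h3 := hQX.posSemidef.dotProduct_mulVec_nonneg ((1 - B * C)ᵀ *ᵥ x)
  have h4 := hD.posSemidef.dotProduct_mulVec_nonneg (Bᵀ *ᵥ x)
  rw [star_trivial] at h3 h4
  by_cases hz : Bᵀ *ᵥ x = 0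
  · have hy : (1 - B * C)ᵀ *ᵥ x = x := by
      rw [transpose_sub, transpose_one, transpose_mul, sub_mulVec, one_mulVec, ← mulVec_mulVec, hz,
        mulVec_zero, sub_zero]
    have h5 := hQX.dotProduct_mulVec_pos hx
    rw [star_trivial] at h5
    rw [hy]
    linarith
  · have h5 := hD.dotProduct_mulVec_pos hz
    rw [star_trivial] at h5
    linarith

lemma posSemidef_noiseCov {n : ℕ} {Q S : Matrix (Fin n) (Fin n) ℝ} (hQ : Q.PosDef)
    (hS : S ∈ errorCovs Q) : (noiseCov Q S).PosSemidef := by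
  have hSs : Sᵀ = S := by
    have := hS.1.isHermitian.eq
    rwa [conjTranspose_eq_transpose_of_trivial] at this
  have hQs : (Q⁻¹)ᵀ = Q⁻¹ := by
    have := hQ.inv.isHermitian.eq
    rwa [conjTranspose_eq_transpose_of_trivial] at this
  have hQi : Q⁻¹ * Q = 1 := nonsing_inv_mul _ ((isUnit_iff_isUnit_det _).1 hQ.isUnit)
  have h1 := hS.1.mul_mul_conjTranspose_same (gain Q S)
  have h2 := hS.2.mul_mul_conjTranspose_same (S * Q⁻¹)
  rw [conjTranspose_eq_transpose_of_trivial] at h1 h2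
  -- A decomposition into congruences of S and of Q - S, both positive semidefinite.
  have h : noiseCov Q S = gain Q S * S * (gain Q S)ᵀ + S * Q⁻¹ * (Q - S) * (S * Q⁻¹)ᵀ := by
    have h3 : S * Q⁻¹ * Q = S := by rw [Matrix.mul_assoc, hQi, Matrix.mul_one]
    rw [noiseCov, gain, transpose_sub, transpose_one, transpose_mul, hSs, hQs,
      Matrix.mul_sub (S * Q⁻¹), h3]
    simp only [Matrix.sub_mul, Matrix.mul_sub, Matrix.one_mul, Matrix.mul_one, Matrix.mul_assoc]
    abel
  rw [h]
  exact h1.add h2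

end Covariances

end LinearAlgebra

/-! ### Linear images and moments of random vectors -/

section MatVec

variable {m n k : ℕ}

/-- `matVec` as a continuous linear map. -/
noncomputable def matVecCLM (A : Matrix (Fin m) (Fin n) ℝ) :
    EuclideanSpace ℝ (Fin n) →L[ℝ] EuclideanSpace ℝ (Fin m) :=
  (Matrix.toEuclideanLin A).toContinuousLinearMap

/-- A coordinate of a Euclidean vector, as a continuous linear map. -/
noncomputable def coordCLM (i : Fin n) : EuclideanSpace ℝ (Fin n) →L[ℝ] ℝ :=
  EuclideanSpace.proj i

lemma coordCLM_apply (i : Fin n) (x : EuclideanSpace ℝ (Fin n)) : coordCLM i x = x i := rfl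

@[fun_prop]
lemma measurable_matVec (A : Matrix (Fin m) (Fin n) ℝ) : Measurable (matVec A) :=
  (matVecCLM A).measurable

lemma matVec_apply (A : Matrix (Fin m) (Fin n) ℝ) (x : EuclideanSpace ℝ (Fin n)) (i : Fin m) :
    matVec A x i = ∑ j, A i j * x j := rfl

lemma matVec_sub (A : Matrix (Fin m) (Fin n) ℝ) (x y : EuclideanSpace ℝ (Fin n)) :
    matVec A (x - y) = matVec A x - matVec A y := (matVecCLM A).map_sub x y

lemma matVec_matVec (A : Matrix (Fin m) (Fin n) ℝ) (B : Matrix (Fin n) (Fin k) ℝ)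
    (x : EuclideanSpace ℝ (Fin k)) : matVec A (matVec B x) = matVec (A * B) x := by
  simp [matVec, Matrix.mulVec_mulVec]

lemma sub_matVec (A B : Matrix (Fin m) (Fin n) ℝ) (x : EuclideanSpace ℝ (Fin n)) :
    matVec (A - B) x = matVec A x - matVec B x := by
  simp [matVec, Matrix.sub_mulVec]

lemma one_matVec (x : EuclideanSpace ℝ (Fin n)) : matVec 1 x = x := by
  simp [matVec]

lemma norm_matVec_of_transpose_mul {A : Matrix (Fin n) (Fin n) ℝ} (hA : Aᵀ * A = 1)
    (x : EuclideanSpace ℝ (Fin n)) : ‖matVec A x‖ = ‖x‖ := by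
  have h : ‖matVec A x‖ ^ 2 = ‖x‖ ^ 2 := by
    rw [← real_inner_self_eq_norm_sq, ← real_inner_self_eq_norm_sq,
      EuclideanSpace.inner_eq_star_dotProduct, EuclideanSpace.inner_eq_star_dotProduct]
    simp only [star_trivial, matVec]
    rw [Matrix.dotProduct_mulVec, ← Matrix.mulVec_transpose, Matrix.mulVec_mulVec, hA,
      Matrix.one_mulVec]
  exact (sq_eq_sq₀ (norm_nonneg _) (norm_nonneg _)).1 h

end MatVec

section Moments

variable {Ω : Type*} [MeasurableSpace Ω] {P : Measure Ω} {m n k : ℕ}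

/-- `E[X Yᵀ] = M`, including the integrability of all entries. -/
def HasCrossMoment (P : Measure Ω) (X : Ω → EuclideanSpace ℝ (Fin m))
    (Y : Ω → EuclideanSpace ℝ (Fin n)) (M : Matrix (Fin m) (Fin n) ℝ) : Prop :=
  ∀ i j, Integrable (fun ω => X ω i * Y ω j) P ∧ ∫ ω, X ω i * Y ω j ∂P = M i j

/-- All components are integrable with mean zero. -/
def HasZeroMean (P : Measure Ω) (X : Ω → EuclideanSpace ℝ (Fin m)) : Prop :=
  ∀ i, Integrable (fun ω => X ω i) P ∧ ∫ ω, X ω i ∂P = 0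

variable {X X' : Ω → EuclideanSpace ℝ (Fin m)} {Y Y' : Ω → EuclideanSpace ℝ (Fin n)}
  {M M' : Matrix (Fin m) (Fin n) ℝ}

lemma HasSecondMoment.congr {Z Z' : Ω → EuclideanSpace ℝ (Fin n)} {S : Matrix (Fin n) (Fin n) ℝ}
    (h : HasSecondMoment P Z S) (hZ : Z =ᵐ[P] Z') : HasSecondMoment P Z' S := fun i j => by
  have he : (fun ω => Z ω i * Z ω j) =ᵐ[P] fun ω => Z' ω i * Z' ω j := by
    filter_upwards [hZ] with ω hω
    rw [hω]
  rw [← integrable_congr he, ← integral_congr_ae he]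
  exact h i j

lemma HasCrossMoment.symm (h : HasCrossMoment P X Y M) : HasCrossMoment P Y X Mᵀ := fun i j => by
  simp only [mul_comm (Y _ i)]
  exact h j i

lemma HasCrossMoment.add_left (h : HasCrossMoment P X Y M) (h' : HasCrossMoment P X' Y M') :
    HasCrossMoment P (fun ω => X ω + X' ω) Y (M + M') := fun i j => by
  simp only [PiLp.add_apply, add_mul, Matrix.add_apply]
  exact ⟨(h i j).1.add (h' i j).1, by
    rw [integral_add (h i j).1 (h' i j).1, (h i j).2, (h' i j).2]⟩

lemma HasCrossMoment.sub_left (h : HasCrossMoment P X Y M) (h' : HasCrossMoment P X' Y M') :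
    HasCrossMoment P (fun ω => X ω - X' ω) Y (M - M') := fun i j => by
  simp only [PiLp.sub_apply, sub_mul, Matrix.sub_apply]
  exact ⟨(h i j).1.sub (h' i j).1, by
    rw [integral_sub (h i j).1 (h' i j).1, (h i j).2, (h' i j).2]⟩

lemma HasCrossMoment.matVec_left (h : HasCrossMoment P X Y M) (A : Matrix (Fin k) (Fin m) ℝ) :
    HasCrossMoment P (fun ω => matVec A (X ω)) Y (A * M) := fun i j => by
  simp only [matVec_apply, Finset.sum_mul, mul_assoc, Matrix.mul_apply]
  have hi : ∀ l ∈ Finset.univ, Integrable (fun ω => A i l * (X ω l * Y ω j)) P :=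
    fun l _ => (h l j).1.const_mul _
  refine ⟨integrable_finsetSum _ hi, ?_⟩
  rw [integral_finsetSum _ hi]
  exact Finset.sum_congr rfl fun l _ => by rw [integral_const_mul, (h l j).2]

lemma HasCrossMoment.add_right (h : HasCrossMoment P X Y M) (h' : HasCrossMoment P X Y' M') :
    HasCrossMoment P X (fun ω => Y ω + Y' ω) (M + M') :=
  (h.symm.add_left h'.symm).symm

lemma HasCrossMoment.sub_right (h : HasCrossMoment P X Y M) (h' : HasCrossMoment P X Y' M') :
    HasCrossMoment P X (fun ω => Y ω - Y' ω) (M - M') :=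
  (h.symm.sub_left h'.symm).symm

lemma HasCrossMoment.matVec_right (h : HasCrossMoment P X Y M) (A : Matrix (Fin k) (Fin n) ℝ) :
    HasCrossMoment P X (fun ω => matVec A (Y ω)) (M * Aᵀ) := by
  have h' := (h.symm.matVec_left A).symm
  rwa [Matrix.transpose_mul, Matrix.transpose_transpose] at h'

lemma HasZeroMean.add (h : HasZeroMean P X) (h' : HasZeroMean P X') :
    HasZeroMean P fun ω => X ω + X' ω := fun i => by
  simp only [PiLp.add_apply]
  exact ⟨(h i).1.add (h' i).1, by rw [integral_add (h i).1 (h' i).1, (h i).2, (h' i).2, add_zero]⟩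

lemma HasZeroMean.sub (h : HasZeroMean P X) (h' : HasZeroMean P X') :
    HasZeroMean P fun ω => X ω - X' ω := fun i => by
  simp only [PiLp.sub_apply]
  exact ⟨(h i).1.sub (h' i).1, by rw [integral_sub (h i).1 (h' i).1, (h i).2, (h' i).2, sub_zero]⟩

lemma HasZeroMean.matVec (h : HasZeroMean P X) (A : Matrix (Fin k) (Fin m) ℝ) :
    HasZeroMean P fun ω => matVec A (X ω) := fun i => by
  simp only [matVec_apply]
  have hi : ∀ l ∈ Finset.univ, Integrable (fun ω => A i l * X ω l) P :=
    fun l _ => (h l).1.const_mul _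
  refine ⟨integrable_finsetSum _ hi, ?_⟩
  rw [integral_finsetSum _ hi]
  exact Finset.sum_eq_zero fun l _ => by rw [integral_const_mul, (h l).2, mul_zero]

lemma HasZeroMean.integrable (h : HasZeroMean P X) : Integrable X P := by
  have h1 : Integrable (fun ω => WithLp.ofLp (X ω)) P := Integrable.of_eval fun i => (h i).1
  exact (PiLp.continuousLinearEquiv 2 ℝ
    fun _ : Fin m => ℝ).symm.toContinuousLinearMap.integrable_comp h1

lemma HasZeroMean.integral_eq_zero (h : HasZeroMean P X) : ∫ ω, X ω ∂P = 0 := by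
  ext i
  have h1 := (coordCLM i).integral_comp_comm
    h.integrable
  simp only [coordCLM_apply] at h1
  rw [← h1, (h i).2]
  rfl

lemma HasCrossMoment.of_indepFun (hX : HasZeroMean P X) (hY : HasZeroMean P Y)
    (hind : IndepFun X Y P) : HasCrossMoment P X Y 0 := fun i j => by
  have h : IndepFun (fun ω => X ω i) (fun ω => Y ω j) P :=
    hind.comp (φ := fun x : EuclideanSpace ℝ (Fin m) => x i)
      (ψ := fun y : EuclideanSpace ℝ (Fin n) => y j) (by fun_prop) (by fun_prop)
  refine ⟨h.integrable_mul (hX i).1 (hY j).1, ?_⟩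
  have h' := h.integral_mul_eq_mul_integral (hX i).1.1 (hY j).1.1
  simp only [Pi.mul_apply] at h'
  rw [h', (hX i).2, zero_mul]
  rfl

lemma distortion_eq_of_hasSecondMoment {X Z : Ω → EuclideanSpace ℝ (Fin n)}
    {S : Matrix (Fin n) (Fin n) ℝ} (h : HasSecondMoment P (fun ω => X ω - Z ω) S) :
    distortion P X Z = ENNReal.ofReal S.trace := by
  have hi : ∀ i ∈ Finset.univ, Integrable (fun ω => (X ω - Z ω) i * (X ω - Z ω) i) P :=
    fun i _ => (h i i).1
  have hn : ∀ ω, ‖X ω - Z ω‖ ^ 2 = ∑ i, (X ω - Z ω) i * (X ω - Z ω) i := fun ω => by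
    rw [EuclideanSpace.real_norm_sq_eq]
    exact Finset.sum_congr rfl fun i _ => sq _
  rw [distortion]
  simp only [hn]
  rw [← ofReal_integral_eq_lintegral_ofReal (integrable_finsetSum _ hi)
    (Filter.Eventually.of_forall fun ω => Finset.sum_nonneg fun i _ => mul_self_nonneg _),
    integral_finsetSum _ hi]
  congr 1
  exact Finset.sum_congr rfl fun i _ => (h i i).2

lemma distortion_congr {X X' Z Z' : Ω → EuclideanSpace ℝ (Fin n)} (hX : X =ᵐ[P] X')
    (hZ : Z =ᵐ[P] Z') : distortion P X Z = distortion P X' Z' := by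
  refine lintegral_congr_ae ?_
  filter_upwards [hX, hZ] with ω h1 h2
  rw [h1, h2]

/-! ### Gaussian vectors -/

lemma hasZeroMean_of_map_eq [IsProbabilityMeasure P] {Q : Matrix (Fin m) (Fin m) ℝ}
    (hXm : Measurable X) (hX : P.map X = multivariateGaussian 0 Q) : HasZeroMean P X := fun i => by
  have hg : IsGaussian (P.map X) := hX ▸ inferInstance
  have h1 : Integrable X P := (HasGaussianLaw.mk hg).integrable
  have h2 : ∫ ω, X ω ∂P = 0 := by
    have h := integral_map (μ := P) (f := id) hXm.aemeasurable (by fun_prop)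
    rw [hX] at h
    simpa using h.symm
  have h3 := (coordCLM i).integral_comp_comm h1
  have h4 := (coordCLM i).integrable_comp h1
  simp only [coordCLM_apply] at h3 h4
  refine ⟨h4, ?_⟩
  rw [h3, h2]
  rfl

lemma memLp_two_eval (hg : HasGaussianLaw X P) (i : Fin m) : MemLp (fun ω => X ω i) 2 P :=
  (hg.map_fun (coordCLM i)).memLp_two

lemma hasCrossMoment_of_map_eq [IsProbabilityMeasure P] {Q : Matrix (Fin m) (Fin m) ℝ}
    (hQ : Q.PosSemidef) (hXm : Measurable X) (hX : P.map X = multivariateGaussian 0 Q) :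
    HasCrossMoment P X X Q := fun i j => by
  have hg : IsGaussian (P.map X) := hX ▸ inferInstance
  have hi := memLp_two_eval (HasGaussianLaw.mk hg) i
  have hj := memLp_two_eval (HasGaussianLaw.mk hg) j
  have hz := hasZeroMean_of_map_eq hXm hX
  refine ⟨hi.integrable_mul hj, ?_⟩
  have h := covariance_eval_multivariateGaussian (μ := 0) hQ i j
  rw [← hX, covariance_map (by fun_prop) (by fun_prop) hXm.aemeasurable] at h
  rw [← h, Function.comp_def, Function.comp_def, covariance_eq_sub hi hj]
  simp only [Pi.mul_apply]
  rw [(hz i).2, zero_mul, sub_zero]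

lemma covariance_eval_eq (hX : HasGaussianLaw X P) (hY : HasGaussianLaw Y P)
    (hz : HasZeroMean P X) (h : HasCrossMoment P X Y M) (i : Fin m) (j : Fin n) :
    cov[fun ω => X ω i, fun ω => Y ω j; P] = M i j := by
  have := hX.isProbabilityMeasure
  rw [covariance_eq_sub (memLp_two_eval hX i) (memLp_two_eval hY j), (hz i).2, zero_mul, sub_zero,
    ← (h i j).2]
  rfl

/-- Jointly Gaussian vectors are independent of side information with which they are
uncorrelated. -/
lemma indepFun_prodMk_of_hasCrossMoment_zero {T Z : Ω → EuclideanSpace ℝ (Fin m)}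
    (hg : HasGaussianLaw (fun ω => ((T ω, Z ω), Y ω)) P) (hT : HasZeroMean P T)
    (hZ : HasZeroMean P Z) (hTY : HasCrossMoment P T Y 0) (hZY : HasCrossMoment P Z Y 0) :
    IndepFun Y (fun ω => (T ω, Z ω)) P := by
  -- The vectors are flattened to families of real coordinates, for which zero covariances of a
  -- jointly Gaussian law give independence of the families.
  let X : Fin m ⊕ Fin m → Ω → ℝ := Sum.elim (fun i ω => T ω i) (fun i ω => Z ω i)
  let p₁ : (EuclideanSpace ℝ (Fin m) × EuclideanSpace ℝ (Fin m)) × EuclideanSpace ℝ (Fin n) →L[ℝ]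
      (Fin m ⊕ Fin m → ℝ) := ContinuousLinearMap.pi (Sum.elim
        (fun i => (coordCLM i) ∘L (ContinuousLinearMap.fst ℝ _ _) ∘L
          (ContinuousLinearMap.fst ℝ _ _))
        (fun i => (coordCLM i) ∘L (ContinuousLinearMap.snd ℝ _ _) ∘L
          (ContinuousLinearMap.fst ℝ _ _)))
  let p₂ : (EuclideanSpace ℝ (Fin m) × EuclideanSpace ℝ (Fin m)) × EuclideanSpace ℝ (Fin n) →L[ℝ]
      (Fin n → ℝ) := ContinuousLinearMap.pi
        (fun j => (coordCLM j) ∘L (ContinuousLinearMap.snd ℝ _ _))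
  have hgX : HasGaussianLaw (fun ω => ((fun i => X i ω), (fun j => Y ω j))) P := by
    have h : (fun ω => ((fun i => X i ω), (fun j => Y ω j))) =
        fun ω => (p₁.prod p₂) ((T ω, Z ω), Y ω) := by
      funext ω
      refine Prod.ext (funext fun i => ?_) rfl
      cases i <;> rfl
    rw [h]
    exact hg.map_fun _
  have hgT : HasGaussianLaw T P := hg.fst.fst
  have hgZ : HasGaussianLaw Z P := hg.fst.snd
  have hgY : HasGaussianLaw Y P := hg.snd
  have hind := hgX.indepFun_of_covariance_eval (X := X) (Y := fun j ω => Y ω j) fun i j => by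
    cases i with
    | inl i => exact covariance_eval_eq hgT hgY hT hTY i j
    | inr i => exact covariance_eval_eq hgZ hgY hZ hZY i j
  exact hind.symm.comp (φ := WithLp.toLp 2)
    (ψ := fun x : Fin m ⊕ Fin m → ℝ =>
      (WithLp.toLp 2 (fun i => x (Sum.inl i)), WithLp.toLp 2 (fun i => x (Sum.inr i))))
    (by fun_prop) (by fun_prop)

lemma iIndepFun_eval_of_diagonal {X : Ω → EuclideanSpace ℝ (Fin n)} {lam : Fin n → ℝ}
    (hg : HasGaussianLaw X P) (hz : HasZeroMean P X)
    (h : HasCrossMoment P X X (Matrix.diagonal lam)) : iIndepFun (fun i ω => X ω i) P := by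
  refine HasGaussianLaw.iIndepFun_of_covariance_eq_zero
    (hg.map_fun (PiLp.continuousLinearEquiv 2 ℝ
      fun _ : Fin n => ℝ).toContinuousLinearMap) fun i j hij => ?_
  rw [covariance_eval_eq hg hg hz h, Matrix.diagonal_apply_ne _ hij]

lemma map_eval_eq_gaussianReal {X : Ω → EuclideanSpace ℝ (Fin n)}
    {Q : Matrix (Fin n) (Fin n) ℝ}
    (hg : HasGaussianLaw X P) (hz : HasZeroMean P X) (h : HasCrossMoment P X X Q) (i : Fin n) :
    P.map (fun ω => X ω i) = gaussianReal 0 (Q i i).toNNReal := by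
  have := (hg.map_fun (coordCLM i))
  simp only [coordCLM_apply] at this
  rw [this.map_eq_gaussianReal, (hz i).2, ← covariance_self this.aemeasurable,
    covariance_eval_eq hg hg hz h]

end Moments

/-! ### Gaussian test channels -/

section TestChannel

variable {Ω : Type*} [MeasurableSpace Ω] {P : Measure Ω} {n : ℕ}

/-- Centered jointly Gaussian vectors `T`, `Z` with `E[T Tᵀ] = Q` and
`E[T Zᵀ] = E[Z Zᵀ] = Q - S`. -/
structure IsTestChannel (P : Measure Ω) (T Z : Ω → EuclideanSpace ℝ (Fin n))
    (Q S : Matrix (Fin n) (Fin n) ℝ) : Prop where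
  hasGaussianLaw : HasGaussianLaw (fun ω => (T ω, Z ω)) P
  measurable_source : Measurable T
  measurable_repro : Measurable Z
  zeroMean_source : HasZeroMean P T
  zeroMean_repro : HasZeroMean P Z
  moment_source : HasCrossMoment P T T Q
  moment_cross : HasCrossMoment P T Z (Q - S)
  moment_repro : HasCrossMoment P Z Z (Q - S)

namespace IsTestChannel

variable {T Z : Ω → EuclideanSpace ℝ (Fin n)} {Q S : Matrix (Fin n) (Fin n) ℝ}

lemma rotate (h : IsTestChannel P T Z Q S) (A : Matrix (Fin n) (Fin n) ℝ) :
    IsTestChannel P (fun ω => matVec A (T ω)) (fun ω => matVec A (Z ω)) (A * Q * Aᵀ)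
      (A * S * Aᵀ) where
  hasGaussianLaw := h.hasGaussianLaw.map_fun ((matVecCLM A).prodMap (matVecCLM A))
  measurable_source := (measurable_matVec A).comp h.measurable_source
  measurable_repro := (measurable_matVec A).comp h.measurable_repro
  zeroMean_source := h.zeroMean_source.matVec A
  zeroMean_repro := h.zeroMean_repro.matVec A
  moment_source := (h.moment_source.matVec_left A).matVec_right A
  moment_cross := by
    rw [← Matrix.sub_mul, ← Matrix.mul_sub]
    exact (h.moment_cross.matVec_left A).matVec_right A
  moment_repro := by
    rw [← Matrix.sub_mul, ← Matrix.mul_sub]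
    exact (h.moment_repro.matVec_left A).matVec_right A

/-- The point of requiring E[T Zᵀ] = E[Z Zᵀ]: the error is orthogonal to the reproduction, so in the
jointly Gaussian case the channel runs backwards as Z plus independent noise. -/
lemma moment_error_repro (h : IsTestChannel P T Z Q S) :
    HasCrossMoment P (fun ω => T ω - Z ω) Z 0 := by
  have h1 := h.moment_cross.sub_left h.moment_repro
  rwa [sub_self] at h1

lemma moment_error (h : IsTestChannel P T Z Q S) :
    HasCrossMoment P (fun ω => T ω - Z ω) (fun ω => T ω - Z ω) S := by
  have hs : (Q - S)ᵀ = Q - S := by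
    ext i j
    have h1 := (h.moment_repro.symm i j).2
    rwa [(h.moment_repro i j).2, eq_comm] at h1
  have h1 := ((h.moment_source.sub_left h.moment_cross.symm).sub_right h.moment_error_repro)
  rwa [hs, sub_zero, sub_sub_cancel] at h1

lemma distortion_eq (h : IsTestChannel P T Z Q S) :
    distortion P T Z = ENNReal.ofReal S.trace :=
  distortion_eq_of_hasSecondMoment h.moment_error

lemma integral_sub_sq (h : IsTestChannel P T Z Q S) (i : Fin n) :
    Integrable (fun ω => (T ω i - Z ω i) ^ 2) P ∧ ∫ ω, (T ω i - Z ω i) ^ 2 ∂P = S i i := by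
  have h1 := h.moment_error i i
  simp only [PiLp.sub_apply, ← sq] at h1
  exact h1

/-- Only the source covariance has to be diagonal, since superadditivity needs independent source
components and nothing about S. -/
lemma sum_mutualInfo_le_of_diagonal [IsProbabilityMeasure P] {lam : Fin n → ℝ}
    (h : IsTestChannel P T Z (Matrix.diagonal lam) S) :
    ∑ t, mutualInfo P (fun ω => T ω t) (fun ω => Z ω t) ≤ mutualInfo P T Z := by
  have hT := h.measurable_source
  have hZ := h.measurable_repro
  refine (sum_mutualInfo_le (fun t => by fun_prop) (fun t => by fun_prop)
    (iIndepFun_eval_of_diagonal h.hasGaussianLaw.fst h.zeroMean_source h.moment_source)).trans ?_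
  exact mutualInfo_comp_le hT hZ (f := WithLp.ofLp) (g := WithLp.ofLp) (by fun_prop) (by fun_prop)

variable {lam del : Fin n → ℝ}

/-- With both matrices diagonal, all covariances between different indices vanish, and joint
Gaussianity gives independence. The `Bool` index separates source from reproduction within a pair.
-/
lemma iIndepFun_pairs (h : IsTestChannel P T Z (Matrix.diagonal lam) (Matrix.diagonal del)) :
    iIndepFun (fun i ω => (T ω i, Z ω i)) P := by
  let X : Fin n → Bool → Ω → ℝ := fun i b ω => bif b then T ω i else Z ω i
  let p : EuclideanSpace ℝ (Fin n) × EuclideanSpace ℝ (Fin n) →L[ℝ] (Fin n → Bool → ℝ) :=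
    ContinuousLinearMap.pi fun i => ContinuousLinearMap.pi fun b =>
      bif b then coordCLM i ∘L ContinuousLinearMap.fst ℝ _ _
        else coordCLM i ∘L ContinuousLinearMap.snd ℝ _ _
  have hX : HasGaussianLaw (fun ω i b => X i b ω) P := by
    have hp : (fun ω i b => X i b ω) = fun ω => p (T ω, Z ω) := by
      funext ω i b
      cases b <;> rfl
    rw [hp]
    exact h.hasGaussianLaw.map_fun p
  have hT := h.hasGaussianLaw.fst
  have hZ := h.hasGaussianLaw.snd
  have hoff : ∀ i j, i ≠ j → (Matrix.diagonal lam - Matrix.diagonal del) i j = 0 := by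
    intro i j hij
    rw [Matrix.sub_apply, Matrix.diagonal_apply_ne _ hij, Matrix.diagonal_apply_ne _ hij, sub_zero]
  have hind : iIndepFun (fun i ω b => X i b ω) P :=
    hX.iIndepFun_of_covariance_eval fun i j hij b c => by
      cases b <;> cases c
      · exact (covariance_eval_eq hZ hZ h.zeroMean_repro h.moment_repro i j).trans (hoff i j hij)
      · have h1 := covariance_eval_eq hZ hT h.zeroMean_repro h.moment_cross.symm i j
        rw [Matrix.transpose_apply, hoff j i hij.symm] at h1
        exact h1
      · exact (covariance_eval_eq hT hZ h.zeroMean_source h.moment_cross i j).trans (hoff i j hij)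
      · exact (covariance_eval_eq hT hT h.zeroMean_source h.moment_source i j).trans
          (Matrix.diagonal_apply_ne _ hij)
  exact hind.comp (fun _ x => (x true, x false)) fun _ => by fun_prop

variable [IsProbabilityMeasure P]

/-- For δ_i > 0 the backward channel gives the value. For δ_i = 0 the upper bound is trivial, and
the scalar rate bound supplies the infinite lower bound. -/
lemma mutualInfo_eval (h : IsTestChannel P T Z (Matrix.diagonal lam) (Matrix.diagonal del))
    (hlam : ∀ i, 0 < lam i) (hdel : ∀ i, 0 ≤ del i ∧ del i ≤ lam i) (i : Fin n) :
    mutualInfo P (fun ω => T ω i) (fun ω => Z ω i) = scalarRate (lam i) (del i) := by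
  have hTm := h.measurable_source
  have hZm := h.measurable_repro
  have hg : HasGaussianLaw (fun ω => (T ω - Z ω, Z ω)) P :=
    h.hasGaussianLaw.map_fun (ContinuousLinearMap.prod
      (ContinuousLinearMap.fst ℝ (EuclideanSpace ℝ (Fin n)) (EuclideanSpace ℝ (Fin n)) -
        ContinuousLinearMap.snd ℝ (EuclideanSpace ℝ (Fin n)) (EuclideanSpace ℝ (Fin n)))
      (ContinuousLinearMap.snd ℝ _ _))
  have hzN := h.zeroMean_source.sub h.zeroMean_repro
  have hX := map_eval_eq_gaussianReal h.hasGaussianLaw.fst h.zeroMean_source h.moment_source i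
  have hN := map_eval_eq_gaussianReal hg.fst hzN h.moment_error i
  rw [Matrix.diagonal_apply_eq] at hX hN
  have hl : (lam i).toNNReal ≠ 0 := (Real.toNNReal_pos.2 (hlam i)).ne'
  obtain ⟨hint, hsq⟩ := h.integral_sub_sq i
  rw [Matrix.diagonal_apply_eq] at hsq
  refine le_antisymm ?_ ?_
  · by_cases hd : del i = 0
    · rw [scalarRate, if_pos hd]
      exact le_top
    have hd0 : 0 < del i := lt_of_le_of_ne (hdel i).1 (Ne.symm hd)
    have hgi : HasGaussianLaw (fun ω => ((T ω - Z ω) i, Z ω i)) P :=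
      hg.map_fun ((coordCLM i).prodMap (coordCLM i))
    have hind := hgi.indepFun_of_covariance_eq_zero
      (covariance_eval_eq hg.fst hg.snd hzN h.moment_error_repro i i)
    rw [mutualInfo_of_indepFun_sub (X := fun ω => T ω i) (Z := fun ω => Z ω i) (by fun_prop)
      (by fun_prop) hX hl (Real.toNNReal_pos.2 hd0).ne' hN hind, Real.coe_toNNReal _ (hlam i).le,
      Real.coe_toNNReal _ hd0.le, scalarRate_of_le hd0 (hdel i).2]
  · have h1 := scalarRate_le_mutualInfo (X := fun ω => T ω i) (Z := fun ω => Z ω i)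
      (by fun_prop) (by fun_prop) hX hl hint
    rwa [hsq, Real.coe_toNNReal _ (hlam i).le] at h1

lemma mutualInfo_eq_sum (h : IsTestChannel P T Z (Matrix.diagonal lam) (Matrix.diagonal del)) :
    mutualInfo P T Z = ∑ t, mutualInfo P (fun ω => T ω t) (fun ω => Z ω t) := by
  have hT := h.measurable_source
  have hZ := h.measurable_repro
  refine le_antisymm ?_ h.sum_mutualInfo_le_of_diagonal
  refine le_trans ?_ (mutualInfo_le_sum (fun t => by fun_prop) (fun t => by fun_prop)
    h.iIndepFun_pairs)
  exact mutualInfo_comp_le (X := fun ω => WithLp.ofLp (T ω)) (Z := fun ω => WithLp.ofLp (Z ω))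
    (by fun_prop) (by fun_prop) (f := WithLp.toLp 2) (g := WithLp.toLp 2) (by fun_prop)
    (by fun_prop)

end IsTestChannel

end TestChannel

/-! ### Lower bounds for the rate distortion functions -/

section LowerBounds

variable {n : ℕ}

/-- The infimum of the sum of the scalar rates over all distributions of the distortion. -/
noncomputable def diagRDF (lam : Fin n → ℝ) (Δ : ℝ) : ℝ≥0∞ :=
  ⨅ del ∈ {del : Fin n → ℝ | (∀ i, 0 ≤ del i) ∧ ∑ i, del i ≤ Δ}, ∑ i, scalarRate (lam i) (del i)

lemma distortion_eq_sum {Ω : Type*} [MeasurableSpace Ω] {P : Measure Ω}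
    {X Z : Ω → EuclideanSpace ℝ (Fin n)} (hX : Measurable X) (hZ : Measurable Z) :
    distortion P X Z = ∑ i, ∫⁻ ω, ENNReal.ofReal ((X ω i - Z ω i) ^ 2) ∂P := by
  have h : ∀ ω, ENNReal.ofReal (‖X ω - Z ω‖ ^ 2) =
      ∑ i, ENNReal.ofReal ((X ω i - Z ω i) ^ 2) := fun ω => by
    rw [EuclideanSpace.real_norm_sq_eq, ENNReal.ofReal_sum_of_nonneg fun i _ => sq_nonneg _]
    rfl
  simp only [distortion, h]
  exact lintegral_finsetSum _ fun i _ => by fun_prop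

/-- The coordinatewise errors of any joint law form an admissible allocation, and the scalar bound
applies to each coordinate. The coordinates of the source need not be independent here. -/
lemma diagRDF_le_coordRDF {ν : Measure (EuclideanSpace ℝ (Fin n))} {lam : Fin n → ℝ}
    (hlam : ∀ i, 0 < lam i) (hν : ∀ i, ν.map (fun x => x i) = gaussianReal 0 (lam i).toNNReal)
    {Δ : ℝ} (hΔ : 0 ≤ Δ) : diagRDF lam Δ ≤ coordRDF ν Δ := by
  refine le_iInf fun π => le_iInf fun hπ => le_iInf fun hπν => le_iInf fun hdist => ?_
  rw [distortion_eq_sum measurable_fst measurable_snd] at hdist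
  have hsum := ne_top_of_le_ne_top ENNReal.ofReal_ne_top hdist
  have hfin := fun i => ENNReal.sum_ne_top.1 hsum i (Finset.mem_univ i)
  have hm : ∀ i, AEStronglyMeasurable (fun p : EuclideanSpace ℝ (Fin n) × EuclideanSpace ℝ (Fin n)
      => (p.1 i - p.2 i) ^ 2) π := fun i => by
    have : Measurable fun p : EuclideanSpace ℝ (Fin n) × EuclideanSpace ℝ (Fin n) =>
      (p.1 i - p.2 i) ^ 2 := by fun_prop
    exact this.aestronglyMeasurable
  have hint : ∀ i, Integrable (fun p : EuclideanSpace ℝ (Fin n) × EuclideanSpace ℝ (Fin n) =>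
      (p.1 i - p.2 i) ^ 2) π := fun i =>
    (lintegral_ofReal_ne_top_iff_integrable (hm i)
      (Filter.Eventually.of_forall fun p => sq_nonneg _)).1 (hfin i)
  have hle : diagRDF lam Δ ≤ ∑ i, scalarRate (lam i) (∫ p, (p.1 i - p.2 i) ^ 2 ∂π) := by
    refine iInf₂_le (fun i => ∫ p, (p.1 i - p.2 i) ^ 2 ∂π)
      ⟨fun i => integral_nonneg fun p => sq_nonneg _, ?_⟩
    -- Since `ENNReal.ofReal` truncates at zero, 0 ≤ Δ is what allows the constraint to be read back
    -- in the reals.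
    rw [← ENNReal.ofReal_le_ofReal_iff hΔ,
      ENNReal.ofReal_sum_of_nonneg fun i _ => integral_nonneg fun p => sq_nonneg _]
    refine le_trans (le_of_eq ?_) hdist
    exact Finset.sum_congr rfl fun i _ => ofReal_integral_eq_lintegral_ofReal (hint i)
      (Filter.Eventually.of_forall fun p => sq_nonneg _)
  refine hle.trans (Finset.sum_le_sum fun i _ => ?_)
  have hX : π.map (fun p => p.1 i) = gaussianReal 0 (lam i).toNNReal := by
    rw [← hν i, ← hπν, Measure.map_map (by fun_prop) measurable_fst]
    rfl
  have h := scalarRate_le_mutualInfo (P := π) (X := fun p => p.1 i) (Z := fun p => p.2 i)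
    (by fun_prop) (by fun_prop) hX (Real.toNNReal_pos.2 (hlam i)).ne' (hint i)
  rwa [Real.coe_toNNReal _ (hlam i).le] at h

lemma coordRDF_le_marginalRDF {ν : Measure (EuclideanSpace ℝ (Fin n))}
    (hν : iIndepFun (fun i x => x i) ν) (Δ : ℝ) : coordRDF ν Δ ≤ marginalRDF ν Δ := by
  refine le_iInf fun π => le_iInf fun hπ => le_iInf fun hπν => le_iInf fun hdist => ?_
  refine (iInf_le_of_le π <| iInf_le_of_le hπ <| iInf_le_of_le hπν <|
    iInf_le_of_le hdist le_rfl).trans ?_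
  have hind : iIndepFun (fun i (p : EuclideanSpace ℝ (Fin n) × EuclideanSpace ℝ (Fin n)) => p.1 i)
      π := by
    have hν' := hν.isProbabilityMeasure
    have h := (iIndepFun_iff_map_fun_eq_pi_map fun i => by fun_prop).1 hν
    rw [iIndepFun_iff_map_fun_eq_pi_map fun i => by fun_prop]
    simp only [← hπν] at h
    rw [Measure.map_map (by fun_prop) measurable_fst] at h
    refine h.trans ?_
    congr 1
    funext i
    rw [Measure.map_map (by fun_prop) measurable_fst]
    rfl
  refine (sum_mutualInfo_le (fun t => by fun_prop) (fun t => by fun_prop) hind).trans ?_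
  exact mutualInfo_comp_le measurable_fst measurable_snd (f := WithLp.ofLp) (g := WithLp.ofLp)
    (by fun_prop) (by fun_prop)

/-- Rotate the joint law: the distortion is preserved and the information does not increase. One
direction suffices, since the circle of inequalities closes elsewhere. -/
lemma marginalRDF_map_matVec_le {ν : Measure (EuclideanSpace ℝ (Fin n))}
    {A : Matrix (Fin n) (Fin n) ℝ} (hA : Aᵀ * A = 1) (Δ : ℝ) :
    marginalRDF (ν.map (matVec A)) Δ ≤ marginalRDF ν Δ := by
  refine le_iInf fun π => le_iInf fun hπ => le_iInf fun hπν => le_iInf fun hdist => ?_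
  have hm : Measurable fun p : EuclideanSpace ℝ (Fin n) × EuclideanSpace ℝ (Fin n) =>
    (matVec A p.1, matVec A p.2) := by fun_prop
  refine iInf_le_of_le (π.map fun p => (matVec A p.1, matVec A p.2)) <|
    iInf_le_of_le (Measure.isProbabilityMeasure_map hm.aemeasurable) <|
    iInf_le_of_le ?_ <| iInf_le_of_le ?_ ?_
  · rw [← hπν, Measure.map_map measurable_fst hm,
      Measure.map_map (measurable_matVec A) measurable_fst]
    rfl
  · refine le_trans (le_of_eq ?_) hdist
    rw [distortion, lintegral_map (by fun_prop) hm]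
    refine lintegral_congr fun p => ?_
    rw [← matVec_sub, norm_matVec_of_transpose_mul hA]
  · rw [mutualInfo_map hm measurable_fst measurable_snd]
    exact mutualInfo_comp_le measurable_fst measurable_snd (measurable_matVec A)
      (measurable_matVec A)

/-- Subtracting BY from source and reproduction turns each competitor of the conditional problem
into one of the unconditional problem, with the same error and no more information. -/
lemma marginalRDF_le_condRDF {ny : ℕ} {Ω : Type*} [MeasurableSpace Ω] {P : Measure Ω}
    [IsProbabilityMeasure P] {X : Ω → EuclideanSpace ℝ (Fin n)}
    {Y : Ω → EuclideanSpace ℝ (Fin ny)} (hX : Measurable X) (hY : Measurable Y)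
    (B : Matrix (Fin n) (Fin ny) ℝ) (hind : IndepFun Y (fun ω => X ω - matVec B (Y ω)) P)
    (Δ : ℝ) : marginalRDF (P.map fun ω => X ω - matVec B (Y ω)) Δ ≤
      condRDF (P.map fun ω => (X ω, Y ω)) Δ := by
  refine le_iInf fun π => le_iInf fun hπ => le_iInf fun hπρ => le_iInf fun hdist => ?_
  set X' : EuclideanSpace ℝ (Fin n) × EuclideanSpace ℝ (Fin ny) × EuclideanSpace ℝ (Fin n) →
    EuclideanSpace ℝ (Fin n) := fun p => p.1 - matVec B p.2.1 with hX'
  set Z' : EuclideanSpace ℝ (Fin n) × EuclideanSpace ℝ (Fin ny) × EuclideanSpace ℝ (Fin n) →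
    EuclideanSpace ℝ (Fin n) := fun p => p.2.2 - matVec B p.2.1 with hZ'
  have hX'm : Measurable X' := by fun_prop
  have hZ'm : Measurable Z' := by fun_prop
  -- A competitor shares with `P` only the law of (X, Y). That is enough to transfer the
  -- independence of Y and X - BY.
  have hlaw : ∀ {β : Type} [MeasurableSpace β]
      {g : EuclideanSpace ℝ (Fin n) × EuclideanSpace ℝ (Fin ny) → β}, Measurable g →
      π.map (fun p => g (p.1, p.2.1)) = P.map fun ω => g (X ω, Y ω) := by
    intro β _ g hg
    have h := congrArg (Measure.map g) hπρ
    rw [Measure.map_map hg (by fun_prop), Measure.map_map hg (hX.prodMk hY)] at h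
    exact h
  have hXl : π.map X' = P.map fun ω => X ω - matVec B (Y ω) :=
    hlaw (g := fun q => q.1 - matVec B q.2) (by fun_prop)
  have hYl : π.map (fun p => p.2.1) = P.map Y := hlaw (g := fun q => q.2) (by fun_prop)
  have hYXl : π.map (fun p => (p.2.1, X' p)) = P.map fun ω => (Y ω, X ω - matVec B (Y ω)) :=
    hlaw (g := fun q => (q.2, q.1 - matVec B q.2)) (by fun_prop)
  have hXBm : Measurable fun ω => X ω - matVec B (Y ω) := by fun_prop
  have hind' : IndepFun (fun p : EuclideanSpace ℝ (Fin n) × EuclideanSpace ℝ (Fin ny) ×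
      EuclideanSpace ℝ (Fin n) => p.2.1) X' π := by
    rw [indepFun_iff_map_prod_eq_prod_map_map (by fun_prop) hX'm.aemeasurable, hYXl, hXl, hYl]
    exact (indepFun_iff_map_prod_eq_prod_map_map hY.aemeasurable hXBm.aemeasurable).1 hind
  refine iInf_le_of_le (π.map fun p => (X' p, Z' p)) <|
    iInf_le_of_le (Measure.isProbabilityMeasure_map (hX'm.prodMk hZ'm).aemeasurable) <|
    iInf_le_of_le ?_ <| iInf_le_of_le ?_ ?_
  · rw [Measure.map_map measurable_fst (hX'm.prodMk hZ'm)]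
    exact hXl
  · refine le_trans (le_of_eq ?_) hdist
    rw [distortion, lintegral_map (by fun_prop) (hX'm.prodMk hZ'm)]
    refine lintegral_congr fun p => ?_
    rw [hX', hZ', sub_sub_sub_cancel_right]
  · rw [mutualInfo_map (hX'm.prodMk hZ'm) measurable_fst measurable_snd]
    exact mutualInfo_sub_le_condMutualInfo (b := matVec B) (by fun_prop) (by fun_prop)
      (by fun_prop) (measurable_matVec B) hind'

end LowerBounds

/-! ### The Gaussian source with side information -/

section Source

variable {Ω : Type*} [MeasurableSpace Ω] {P : Measure Ω} [IsProbabilityMeasure P]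

/-- Translating by a function of `Y` does not affect the deviation from the conditional mean. -/
lemma centered_ae_eq {n : ℕ} {𝓨 : Type*} [MeasurableSpace 𝓨]
    {T : Ω → EuclideanSpace ℝ (Fin n)} {Y : Ω → 𝓨} {b : 𝓨 → EuclideanSpace ℝ (Fin n)}
    (hTm : Measurable T) (hY : Measurable Y) (hb : Measurable b) (hT : HasZeroMean P T)
    (hbY : Integrable (fun ω => b (Y ω)) P) (hind : IndepFun Y T P) :
    centered P (fun ω => T ω + b (Y ω)) Y =ᵐ[P] T := by
  have hle : MeasurableSpace.comap Y inferInstance ≤ ‹MeasurableSpace Ω› := hY.comap_le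
  have h1 := condExp_add hT.integrable hbY (MeasurableSpace.comap Y inferInstance)
  have hTs : StronglyMeasurable[MeasurableSpace.comap T inferInstance] T :=
    (comap_measurable T).stronglyMeasurable
  have h2 := condExp_indep_eq hTm.comap_le hle hTs hind.symm
  have hbs : StronglyMeasurable[MeasurableSpace.comap Y inferInstance] fun ω => b (Y ω) :=
    (hb.comp (comap_measurable Y)).stronglyMeasurable
  have h3 := condExp_of_stronglyMeasurable hle hbs hbY
  rw [h3] at h1
  filter_upwards [h1, h2] with ω hω1 hω2
  have h4 : condMean P (fun ω => T ω + b (Y ω)) Y ω = b (Y ω) := by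
    refine hω1.trans ?_
    rw [Pi.add_apply, hω2, hT.integral_eq_zero, zero_add]
  rw [centered, h4, add_sub_cancel_right]

variable {nx ny : ℕ} {QX : Matrix (Fin nx) (Fin nx) ℝ} {C : Matrix (Fin ny) (Fin nx) ℝ}
  {D : Matrix (Fin ny) (Fin ny) ℝ} {X : Ω → EuclideanSpace ℝ (Fin nx)}
  {V : Ω → EuclideanSpace ℝ (Fin ny)} {W : Ω → EuclideanSpace ℝ (Fin nx)}
  {S : Matrix (Fin nx) (Fin nx) ℝ} {Y : Ω → EuclideanSpace ℝ (Fin ny)}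

lemma hasZeroMean_side (hXm : Measurable X) (hVm : Measurable V)
    (hX : P.map X = multivariateGaussian 0 QX) (hV : P.map V = multivariateGaussian 0 1)
    (hY : ∀ ω, Y ω = matVec C (X ω) + matVec D (V ω)) : HasZeroMean P Y := by
  obtain rfl : Y = fun ω => matVec C (X ω) + matVec D (V ω) := funext hY
  exact ((hasZeroMean_of_map_eq hXm hX).matVec C).add ((hasZeroMean_of_map_eq hVm hV).matVec D)

/-- A computation of second moments from those of (X, V, W). The regression makes T orthogonal to Y,
hence so is Z = HT + W. The identity HQ = Q - S gives the cross moment, and E[Z Zᵀ] = H(Q - S) + HS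
= HQ explains the choice of noise covariance. Joint Gaussianity converts the orthogonality to Y into
independence. -/
lemma isTestChannel_of_source (hQX : QX.PosDef) (hD : (D * Dᵀ).PosDef) (hXm : Measurable X)
    (hVm : Measurable V) (hWm : Measurable W) (hX : P.map X = multivariateGaussian 0 QX)
    (hV : P.map V = multivariateGaussian 0 1)
    (hS : S ∈ errorCovs (condCov QX C D))
    (hW : P.map W = multivariateGaussian 0 (noiseCov (condCov QX C D) S))
    (hXV : IndepFun X V P) (hWXV : IndepFun W (fun ω => (X ω, V ω)) P)
    (hY : ∀ ω, Y ω = matVec C (X ω) + matVec D (V ω)) :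
    IsTestChannel P (fun ω => X ω - matVec (regression QX C D) (Y ω))
      (fun ω => matVec (gain (condCov QX C D) S) (X ω - matVec (regression QX C D) (Y ω)) + W ω)
      (condCov QX C D) S ∧
    IndepFun Y (fun ω => (X ω - matVec (regression QX C D) (Y ω),
      matVec (gain (condCov QX C D) S) (X ω - matVec (regression QX C D) (Y ω)) + W ω)) P := by
  have hYz := hasZeroMean_side hXm hVm hX hV hY
  have hQX' : QXᵀ = QX := by
    have := hQX.isHermitian.eq
    rwa [Matrix.conjTranspose_eq_transpose_of_trivial] at this
  have hQ := posDef_condCov (C := C) hQX hD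
  have hQeq := condCov_eq (C := C) (D := D) hQX
  have hreg := regression_mul_sideCov (C := C) hQX hD
  set B := regression QX C D
  set Q := condCov QX C D
  set H := gain Q S with hH
  have hQ' : Qᵀ = Q := by
    have := hQ.isHermitian.eq
    rwa [Matrix.conjTranspose_eq_transpose_of_trivial] at this
  have hS' : Sᵀ = S := by
    have := hS.1.isHermitian.eq
    rwa [Matrix.conjTranspose_eq_transpose_of_trivial] at this
  have hdet : IsUnit Q.det := (Matrix.isUnit_iff_isUnit_det _).1 hQ.isUnit
  have hHQ : H * Q = Q - S := by
    rw [hH, gain, Matrix.sub_mul, Matrix.one_mul, Matrix.mul_assoc, Matrix.nonsing_inv_mul _ hdet,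
      Matrix.mul_one]
  have hQH : Q * Hᵀ = Q - S := by
    have h := congrArg Matrix.transpose hHQ
    rwa [Matrix.transpose_mul, Matrix.transpose_sub, hQ', hS'] at h
  obtain rfl : Y = fun ω => matVec C (X ω) + matVec D (V ω) := funext hY
  have hXz := hasZeroMean_of_map_eq hXm hX
  have hVz := hasZeroMean_of_map_eq hVm hV
  have hWz := hasZeroMean_of_map_eq hWm hW
  have hXX := hasCrossMoment_of_map_eq hQX.posSemidef hXm hX
  have hVV := hasCrossMoment_of_map_eq Matrix.PosSemidef.one hVm hV
  have hWW := hasCrossMoment_of_map_eq (posSemidef_noiseCov hQ hS) hWm hW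
  have hXV0 := HasCrossMoment.of_indepFun hXz hVz hXV
  have hWX0 := HasCrossMoment.of_indepFun hWz hXz (hWXV.comp measurable_id measurable_fst)
  have hWV0 := HasCrossMoment.of_indepFun hWz hVz (hWXV.comp measurable_id measurable_snd)
  have hXY := (hXX.matVec_right C).add_right (hXV0.matVec_right D)
  have hVY := (hXV0.symm.matVec_right C).add_right (hVV.matVec_right D)
  have hWY := (hWX0.matVec_right C).add_right (hWV0.matVec_right D)
  rw [Matrix.zero_mul, add_zero] at hXY
  rw [Matrix.transpose_zero, Matrix.zero_mul, zero_add, Matrix.one_mul] at hVY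
  rw [Matrix.zero_mul, Matrix.zero_mul, add_zero] at hWY
  have hYY := (hXY.matVec_left C).add_left (hVY.matVec_left D)
  rw [← Matrix.mul_assoc] at hYY
  have hTY := hXY.sub_left (hYY.matVec_left B)
  rw [show C * QX * Cᵀ + D * Dᵀ = sideCov QX C D from rfl, hreg, sub_self] at hTY
  have hTX := hXX.sub_left (hXY.symm.matVec_left B)
  rw [Matrix.transpose_mul, Matrix.transpose_transpose, hQX', ← hQeq] at hTX
  have hTT := hTX.sub_right (hTY.matVec_right B)
  rw [Matrix.zero_mul, sub_zero] at hTT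
  have hWT := hWX0.sub_right (hWY.matVec_right B)
  rw [Matrix.zero_mul, sub_zero] at hWT
  have hTZ := (hTT.matVec_right H).add_right hWT.symm
  rw [hQH, Matrix.transpose_zero, add_zero] at hTZ
  have hWZ := (hWT.matVec_right H).add_right hWW
  rw [Matrix.zero_mul, zero_add] at hWZ
  have hZZ := (hTZ.matVec_left H).add_left hWZ
  rw [noiseCov, ← hH, ← Matrix.mul_add, sub_add_cancel, hHQ] at hZZ
  have hZY := (hTY.matVec_left H).add_left hWY
  rw [Matrix.mul_zero, add_zero] at hZY
  have hTz := hXz.sub (hYz.matVec B)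
  have hZz := (hTz.matVec H).add hWz
  have hXg : HasGaussianLaw X P := HasGaussianLaw.mk (hX ▸ inferInstance)
  have hVg : HasGaussianLaw V P := HasGaussianLaw.mk (hV ▸ inferInstance)
  have hWg : HasGaussianLaw W P := HasGaussianLaw.mk (hW ▸ inferInstance)
  -- All vectors involved are linear images of the jointly Gaussian triple (W, (X, V)).
  have hg := hWXV.hasGaussianLaw hWg (hXV.hasGaussianLaw hXg hVg)
  let w := ContinuousLinearMap.fst ℝ (EuclideanSpace ℝ (Fin nx))
    (EuclideanSpace ℝ (Fin nx) × EuclideanSpace ℝ (Fin ny))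
  let q := ContinuousLinearMap.snd ℝ (EuclideanSpace ℝ (Fin nx))
    (EuclideanSpace ℝ (Fin nx) × EuclideanSpace ℝ (Fin ny))
  let x := (ContinuousLinearMap.fst ℝ (EuclideanSpace ℝ (Fin nx))
    (EuclideanSpace ℝ (Fin ny))) ∘L q
  let v := (ContinuousLinearMap.snd ℝ (EuclideanSpace ℝ (Fin nx))
    (EuclideanSpace ℝ (Fin ny))) ∘L q
  let y := matVecCLM C ∘L x + matVecCLM D ∘L v
  let t := x - matVecCLM B ∘L y
  let z := matVecCLM H ∘L t + w
  have hgT := hg.map_fun ((t.prod z).prod y)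
  exact ⟨⟨hgT.fst, by fun_prop, by fun_prop, hTz, hZz, hTT, hTZ, hZZ⟩,
    indepFun_prodMk_of_hasCrossMoment_zero hgT hTz hZz hTY hZY⟩

end Source

/-! ### Upper bounds from realized random variables -/

section Attained

variable {Ω : Type*} [MeasurableSpace Ω] {P : Measure Ω} {n ny : ℕ}
  {X Z : Ω → EuclideanSpace ℝ (Fin n)}

lemma distortion_map {Ω' : Type*} [MeasurableSpace Ω'] {f : Ω → Ω'} (hf : Measurable f)
    {X Z : Ω' → EuclideanSpace ℝ (Fin n)} (hX : Measurable X) (hZ : Measurable Z) :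
    distortion (P.map f) X Z = distortion P (fun ω => X (f ω)) (fun ω => Z (f ω)) :=
  lintegral_map (by fun_prop) hf

variable [IsProbabilityMeasure P]

lemma condMutualInfo_map {Ω' 𝓧 𝓩 𝓨 : Type*} [MeasurableSpace Ω'] [MeasurableSpace 𝓧]
    [StandardBorelSpace 𝓧] [Nonempty 𝓧] [MeasurableSpace 𝓩] [StandardBorelSpace 𝓩] [Nonempty 𝓩]
    [MeasurableSpace 𝓨] {f : Ω → Ω'} (hf : Measurable f) {X : Ω' → 𝓧} {Z : Ω' → 𝓩} {Y : Ω' → 𝓨}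
    (hX : Measurable X) (hZ : Measurable Z) (hY : Measurable Y) :
    condMutualInfo (P.map f) X Z Y =
      condMutualInfo P (fun ω => X (f ω)) (fun ω => Z (f ω)) (fun ω => Y (f ω)) := by
  simp only [condMutualInfo, condDistrib]
  rw [Measure.map_map (hY.prodMk (hX.prodMk hZ)) hf, Measure.map_map hY hf]
  simp only [Measure.map_map (hY.prodMk hX) hf, Measure.map_map (hY.prodMk hZ) hf]
  rfl

lemma condRDF_le_condMutualInfo {Y : Ω → EuclideanSpace ℝ (Fin ny)} (hX : Measurable X)
    (hZ : Measurable Z) (hY : Measurable Y) {Δ : ℝ}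
    (hdist : distortion P X Z ≤ ENNReal.ofReal Δ) :
    condRDF (P.map fun ω => (X ω, Y ω)) Δ ≤ condMutualInfo P X Z Y := by
  have hm : Measurable fun ω => (X ω, Y ω, Z ω) := hX.prodMk (hY.prodMk hZ)
  have hπ := Measure.isProbabilityMeasure_map (μ := P) hm.aemeasurable
  refine iInf_le_of_le (P.map fun ω => (X ω, Y ω, Z ω)) <| iInf_le_of_le hπ <|
    iInf_le_of_le ?_ <| iInf_le_of_le ?_ ?_
  · rw [Measure.map_map (by fun_prop) hm]
    rfl
  · rwa [distortion_map hm (by fun_prop) (by fun_prop)]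
  · rw [condMutualInfo_map hm (by fun_prop) (by fun_prop) (by fun_prop)]

lemma coordRDF_le_sum_mutualInfo (hX : Measurable X) (hZ : Measurable Z) {Δ : ℝ}
    (hdist : distortion P X Z ≤ ENNReal.ofReal Δ) :
    coordRDF (P.map X) Δ ≤ ∑ t, mutualInfo P (fun ω => X ω t) (fun ω => Z ω t) := by
  have hm : Measurable fun ω => (X ω, Z ω) := hX.prodMk hZ
  refine iInf_le_of_le (P.map fun ω => (X ω, Z ω)) <|
    iInf_le_of_le (Measure.isProbabilityMeasure_map hm.aemeasurable) <|
    iInf_le_of_le ?_ <| iInf_le_of_le ?_ (Finset.sum_le_sum fun t _ => ?_)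
  · rw [Measure.map_map measurable_fst hm]
    rfl
  · rwa [distortion_map hm measurable_fst measurable_snd]
  · rw [mutualInfo_map hm (by fun_prop) (by fun_prop)]

end Attained

/-! ### Allocations of the distortion and diagonal error covariances -/

section Diag

variable {n : ℕ} {lam : Fin n → ℝ} {Δ : ℝ} {Q U : Matrix (Fin n) (Fin n) ℝ}

lemma conj_diagonal_min_mem (hU : U * Uᵀ = 1) (hU' : Uᵀ * U = 1)
    (hlam : ∀ i, 0 < lam i) (hQ : Q = U * Matrix.diagonal lam * Uᵀ) {del : Fin n → ℝ}
    (hdel : (∀ i, 0 ≤ del i) ∧ ∑ i, del i ≤ Δ) :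
    U * Matrix.diagonal (fun i => min (del i) (lam i)) * Uᵀ ∈ feasible Q Δ ∧
      Q * (U * Matrix.diagonal (fun i => min (del i) (lam i)) * Uᵀ) =
        (U * Matrix.diagonal (fun i => min (del i) (lam i)) * Uᵀ) * Q := by
  subst hQ
  refine ⟨⟨(mem_errorCovs_conj_iff hU').2 fun i =>
    ⟨le_min (hdel.1 i) (hlam i).le, min_le_right _ _⟩, ?_⟩, ?_⟩
  · rw [← trace_transpose_mul_mul hU, transpose_mul_conj_mul hU', Matrix.trace_diagonal]
    exact (Finset.sum_le_sum fun i _ => min_le_left _ _).trans hdel.2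
  · rw [conj_mul_conj hU', conj_mul_conj hU', Matrix.diagonal_mul_diagonal,
      Matrix.diagonal_mul_diagonal]
    simp only [mul_comm]

/-- An infimum over error covariances equals `diagRDF` as soon as it is bounded below by it and
attains the sum of the scalar rates for the diagonal error covariances. -/
lemma diagRDF_eq_biInf (hU : U * Uᵀ = 1) (hU' : Uᵀ * U = 1)
    (hlam : ∀ i, 0 < lam i) (hQ : Q = U * Matrix.diagonal lam * Uᵀ)
    {s : Set (Matrix (Fin n) (Fin n) ℝ)} {f : Matrix (Fin n) (Fin n) ℝ → ℝ≥0∞}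
    (hs : ∀ S, S ∈ feasible Q Δ → Q * S = S * Q → S ∈ s)
    (hle : ∀ S ∈ s, diagRDF lam Δ ≤ f S)
    (hf : ∀ del : Fin n → ℝ, U * Matrix.diagonal del * Uᵀ ∈ errorCovs Q →
      f (U * Matrix.diagonal del * Uᵀ) = ∑ i, scalarRate (lam i) (del i)) :
    diagRDF lam Δ = ⨅ S ∈ s, f S := by
  refine le_antisymm (le_iInf₂ hle) (le_iInf₂ fun del hdel => ?_)
  obtain ⟨hm, hc⟩ := conj_diagonal_min_mem hU hU' hlam hQ hdel
  refine (iInf₂_le _ (hs _ hm hc)).trans (le_of_eq ?_)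
  rw [hf _ hm.1]
  exact Finset.sum_congr rfl fun i _ => scalarRate_min (hlam i)

/-- The diagonal of UᵀSU is an allocation with sum tr S, and Hadamard's inequality compares its cost
with the determinant rate. -/
lemma diagRDF_le_detRate (hU : U * Uᵀ = 1) (hU' : Uᵀ * U = 1)
    (hlam : ∀ i, 0 < lam i) (hQ : Q = U * Matrix.diagonal lam * Uᵀ)
    {S : Matrix (Fin n) (Fin n) ℝ} (hS : S ∈ feasible Q Δ) : diagRDF lam Δ ≤ detRate Q S := by
  refine le_trans (iInf₂_le (fun i => (Uᵀ * S * U) i i) ⟨fun i =>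
    (diag_transpose_mul_mul_mem_Icc hU' hQ hS.1 i).1, ?_⟩)
    (sum_scalarRate_le_detRate hU hU' hlam hQ hS.1)
  refine le_trans (le_of_eq ?_) hS.2
  rw [← trace_transpose_mul_mul hU]
  rfl

/-- A common spectral decomposition of commuting matrices, with prescribed order of the
eigenvalues of the first. -/
lemma exists_common_diagonalization (hU : U * Uᵀ = 1) (hU' : Uᵀ * U = 1)
    (hQ : Q = U * Matrix.diagonal lam * Uᵀ) {S : Matrix (Fin n) (Fin n) ℝ} (hS : S.IsHermitian)
    (hc : Q * S = S * Q) :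
    ∃ (U₁ : Matrix (Fin n) (Fin n) ℝ) (del : Fin n → ℝ), U₁ * U₁ᵀ = 1 ∧ U₁ᵀ * U₁ = 1 ∧
      Q = U₁ * Matrix.diagonal lam * U₁ᵀ ∧ S = U₁ * Matrix.diagonal del * U₁ᵀ := by
  have hM : (Uᵀ * S * U).IsHermitian := by
    have h := Matrix.isHermitian_conjTranspose_mul_mul U hS
    rwa [Matrix.conjTranspose_eq_transpose_of_trivial] at h
  have hSU := conj_transpose_mul_mul hU S
  have hcM : Matrix.diagonal lam * (Uᵀ * S * U) = (Uᵀ * S * U) * Matrix.diagonal lam := by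
    rw [hQ, ← hSU, conj_mul_conj hU', conj_mul_conj hU'] at hc
    rw [← transpose_mul_conj_mul hU' (Matrix.diagonal lam * (Uᵀ * S * U)), hc,
      transpose_mul_conj_mul hU']
  -- Because `V` commutes with `diagonal lam`, replacing U by UV leaves the decomposition of Q and
  -- the order of its eigenvalues intact.
  obtain ⟨V, del, hV, hV', hlV, hMV⟩ := exists_orthogonal_of_commute_diagonal hM hcM
  refine ⟨U * V, del, ?_, ?_, ?_, ?_⟩
  · rw [Matrix.transpose_mul, Matrix.mul_assoc, ← Matrix.mul_assoc V, hV, Matrix.one_mul, hU]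
  · rw [Matrix.transpose_mul, Matrix.mul_assoc, ← Matrix.mul_assoc Uᵀ, hU', Matrix.one_mul, hV']
  · rw [Matrix.mul_assoc U V, ← hlV, Matrix.transpose_mul, hQ]
    simp only [Matrix.mul_assoc]
    rw [← Matrix.mul_assoc V, hV, Matrix.one_mul]
  · rw [← hSU, hMV, Matrix.transpose_mul]
    simp only [Matrix.mul_assoc]

end Diag

end GaussRDF

/-! ### The main theorem -/

open GaussRDF in
theorem mainTheorem5
    {nx ny : ℕ}
    -- the source: `X ~ N(0, QX)`, `V ~ N(0, I)` independent of `X`, and `Y = C X + D V`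
    (QX : Matrix (Fin nx) (Fin nx) ℝ) (C : Matrix (Fin ny) (Fin nx) ℝ)
    (D : Matrix (Fin ny) (Fin ny) ℝ)
    (hQX : QX.PosDef) (hD : (D * Dᵀ).PosDef)
    {Ω : Type*} [MeasurableSpace Ω] (P : Measure Ω) [IsProbabilityMeasure P]
    (X : Ω → EuclideanSpace ℝ (Fin nx)) (V Y : Ω → EuclideanSpace ℝ (Fin ny))
    (hXmeas : Measurable X) (hVmeas : Measurable V)
    (hX : P.map X = multivariateGaussian 0 QX)
    (hV : P.map V = multivariateGaussian 0 1)
    (hXV : IndepFun X V P)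
    (hY : ∀ ω, Y ω = matVec C (X ω) + matVec D (V ω))
    -- the conditional covariance and its spectral decomposition
    (Q : Matrix (Fin nx) (Fin nx) ℝ) (hQ : Q = condCov QX C D)
    (U : Matrix (Fin nx) (Fin nx) ℝ) (hU : U * Uᵀ = 1) (hU' : Uᵀ * U = 1)
    (lam : Fin nx → ℝ) (hlam : Antitone lam) (hQU : Q = U * Matrix.diagonal lam * Uᵀ)
    -- for every error covariance `S`, the noise `W S ~ N(0, Q_W)`, independent of `(X, V)`,
    -- and the reproduction `Xh S = H X + (I - H) Q_{X,Y} Q_Y⁻¹ Y + W S`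
    (W Xh : Matrix (Fin nx) (Fin nx) ℝ → Ω → EuclideanSpace ℝ (Fin nx))
    (hWmeas : ∀ S ∈ errorCovs Q, Measurable (W S))
    (hW : ∀ S ∈ errorCovs Q, P.map (W S) = multivariateGaussian 0 (noiseCov Q S))
    (hWind : ∀ S ∈ errorCovs Q, IndepFun (W S) (fun ω => (X ω, V ω)) P)
    (hXh : ∀ S ∈ errorCovs Q, ∀ ω, Xh S ω =
      matVec (gain Q S) (X ω) + matVec ((1 - gain Q S) * regression QX C D) (Y ω) + W S ω)
    -- the translated variables and their rotations
    (bX : Ω → EuclideanSpace ℝ (Fin nx)) (hbX : bX = centered P X Y)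
    (bXh : Matrix (Fin nx) (Fin nx) ℝ → Ω → EuclideanSpace ℝ (Fin nx))
    (hbXh : ∀ S, bXh S = centered P (Xh S) Y)
    (rX : Ω → EuclideanSpace ℝ (Fin nx)) (hrX : ∀ ω, rX ω = matVec Uᵀ (bX ω))
    (rXh : Matrix (Fin nx) (Fin nx) ℝ → Ω → EuclideanSpace ℝ (Fin nx))
    (hrXh : ∀ S ω, rXh S ω = matVec Uᵀ (bXh S ω)) :
    -- (1) translation by the conditional means, for every test channel
    (bX =ᵐ[P] fun ω => X ω - matVec (regression QX C D) (Y ω)) ∧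
    HasSecondMoment P bX Q ∧
    (∀ S ∈ errorCovs Q,
      (bXh S =ᵐ[P] fun ω => Xh S ω - matVec (regression QX C D) (Y ω)) ∧
      (bXh S =ᵐ[P] fun ω => matVec (gain Q S) (bX ω) + W S ω) ∧
      condMutualInfo P X (Xh S) Y = mutualInfo P bX (bXh S) ∧
      mutualInfo P bX (bXh S) = mutualInfo P rX (rXh S) ∧
      HasSecondMoment P (fun ω => X ω - Xh S ω) S ∧
      distortion P X (Xh S) = distortion P bX (bXh S) ∧
      distortion P bX (bXh S) = distortion P rX (rXh S) ∧
      distortion P rX (rXh S) = ENNReal.ofReal S.trace ∧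
      ∑ t, mutualInfo P (fun ω => rX ω t) (fun ω => rXh S ω t) ≤ mutualInfo P rX (rXh S)) ∧
    -- (2) the equalities and the inequality for the rate distortion function
    (∀ Δ : ℝ, 0 ≤ Δ →
      condRDF (P.map fun ω => (X ω, Y ω)) Δ =
        ⨅ S ∈ feasible Q Δ, condMutualInfo P X (Xh S) Y ∧
      condRDF (P.map fun ω => (X ω, Y ω)) Δ = ⨅ S ∈ feasible Q Δ, detRate Q S ∧
      condRDF (P.map fun ω => (X ω, Y ω)) Δ =
        ⨅ S ∈ {S | S ∈ errorCovs Q ∧ distortion P bX (bXh S) ≤ ENNReal.ofReal Δ},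
          mutualInfo P bX (bXh S) ∧
      condRDF (P.map fun ω => (X ω, Y ω)) Δ =
        ⨅ S ∈ {S | S ∈ errorCovs Q ∧ distortion P rX (rXh S) ≤ ENNReal.ofReal Δ},
          mutualInfo P rX (rXh S) ∧
      condRDF (P.map fun ω => (X ω, Y ω)) Δ ≥
        ⨅ S ∈ {S | S ∈ errorCovs Q ∧ distortion P rX (rXh S) ≤ ENNReal.ofReal Δ},
          ∑ t, mutualInfo P (fun ω => rX ω t) (fun ω => rXh S ω t) ∧
      -- the same with the infima over all joint laws that meet the distortion constraint
      condRDF (P.map fun ω => (X ω, Y ω)) Δ = marginalRDF (P.map bX) Δ ∧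
      condRDF (P.map fun ω => (X ω, Y ω)) Δ = marginalRDF (P.map rX) Δ ∧
      condRDF (P.map fun ω => (X ω, Y ω)) Δ ≥ coordRDF (P.map rX) Δ) ∧
    -- (3) the commuting case: a common spectral decomposition exists ...
    (∀ S ∈ errorCovs Q, Q * S = S * Q →
      (gain Q S).PosSemidef ∧
      ∃ (U₁ : Matrix (Fin nx) (Fin nx) ℝ) (del : Fin nx → ℝ),
        U₁ * U₁ᵀ = 1 ∧ U₁ᵀ * U₁ = 1 ∧
        Q = U₁ * Matrix.diagonal lam * U₁ᵀ ∧ S = U₁ * Matrix.diagonal del * U₁ᵀ ∧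
        mutualInfo P (fun ω => matVec U₁ᵀ (bX ω)) (fun ω => matVec U₁ᵀ (bXh S ω)) =
          ∑ t, mutualInfo P (fun ω => matVec U₁ᵀ (bX ω) t) (fun ω => matVec U₁ᵀ (bXh S ω) t)) ∧
    -- ... if `U` is one, the sum over the coordinates attains the mutual information ...
    (∀ S ∈ errorCovs Q, ∀ del : Fin nx → ℝ, S = U * Matrix.diagonal del * Uᵀ →
      HasSecondMoment P (fun ω => rX ω - rXh S ω) (Matrix.diagonal del) ∧
      mutualInfo P rX (rXh S) = ∑ t, mutualInfo P (fun ω => rX ω t) (fun ω => rXh S ω t) ∧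
      condMutualInfo P X (Xh S) Y = ∑ i, scalarRate (lam i) (del i)) ∧
    -- ... and the rate distortion function decomposes
    (∀ Δ : ℝ, 0 ≤ Δ →
      condRDF (P.map fun ω => (X ω, Y ω)) Δ =
        ⨅ S ∈ {S | S ∈ feasible Q Δ ∧ Q * S = S * Q}, condMutualInfo P X (Xh S) Y ∧
      condRDF (P.map fun ω => (X ω, Y ω)) Δ =
        ⨅ S ∈ {S | S ∈ feasible Q Δ ∧ Q * S = S * Q},
          ∑ t, mutualInfo P (fun ω => rX ω t) (fun ω => rXh S ω t) ∧
      condRDF (P.map fun ω => (X ω, Y ω)) Δ =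
        ⨅ S ∈ {S | S ∈ errorCovs Q ∧ distortion P rX (rXh S) ≤ ENNReal.ofReal Δ},
          ∑ t, mutualInfo P (fun ω => rX ω t) (fun ω => rXh S ω t) ∧
      condRDF (P.map fun ω => (X ω, Y ω)) Δ = coordRDF (P.map rX) Δ ∧
      condRDF (P.map fun ω => (X ω, Y ω)) Δ =
        ⨅ S ∈ {S | S ∈ feasible Q Δ ∧ Q * S = S * Q},
          ∑ i, scalarRate (lam i) (∫ ω, (rX ω i - rXh S ω i) ^ 2 ∂P) ∧
      condRDF (P.map fun ω => (X ω, Y ω)) Δ =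
        ⨅ del ∈ {del : Fin nx → ℝ | (∀ i, 0 ≤ del i) ∧ ∑ i, del i ≤ Δ},
          ∑ i, scalarRate (lam i) (del i)) := by
  have hQpd : Q.PosDef := hQ ▸ posDef_condCov hQX hD
  have hlam0 : ∀ i, 0 < lam i := pos_of_posDef_conj hU' (hQU ▸ hQpd)
  have hYm : Measurable Y := by
    obtain rfl : Y = fun ω => matVec C (X ω) + matVec D (V ω) := funext hY
    fun_prop
  have hYz := hasZeroMean_side hXmeas hVmeas hX hV hY
  set B := regression QX C D with hB
  set T : Ω → EuclideanSpace ℝ (Fin nx) := fun ω => X ω - matVec B (Y ω) with hT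
  set Z : Matrix (Fin nx) (Fin nx) ℝ → Ω → EuclideanSpace ℝ (Fin nx) :=
    fun S ω => matVec (gain Q S) (T ω) + W S ω with hZ
  have hsource : ∀ S ∈ errorCovs Q, IsTestChannel P T (Z S) Q S ∧
      IndepFun Y (fun ω => (T ω, Z S ω)) P := by
    intro S hS
    have hWS := hW S hS
    simp only [hZ, hT, hB]
    rw [hQ] at hS hWS ⊢
    exact isTestChannel_of_source hQX hD hXmeas hVmeas (hWmeas S (hQ ▸ hS)) hX hV hS hWS hXV
      (hWind S (hQ ▸ hS)) hY
  have hch := fun S hS => (hsource S hS).1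
  -- The side-information term (I - H)BY restores the part of BY that H(X - BY) removes, so the
  -- reproduction is the test channel output shifted by BY.
  have hXhZ : ∀ S ∈ errorCovs Q, Xh S = fun ω => Z S ω + matVec B (Y ω) := by
    intro S hS
    funext ω
    simp only [hZ, hT]
    rw [hXh S hS, matVec_sub, Matrix.sub_mul, Matrix.one_mul, sub_matVec, matVec_matVec]
    abel
  have hXhm : ∀ S ∈ errorCovs Q, Measurable (Xh S) := by
    intro S hS
    have := (hch S hS).measurable_repro
    rw [hXhZ S hS]
    fun_prop
  have hBY := (hYz.matVec B).integrable
  -- S = 0 serves as a sample channel, from which the facts about the source T alone are extracted.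
  have h0 : (0 : Matrix (Fin nx) (Fin nx) ℝ) ∈ errorCovs Q :=
    ⟨Matrix.PosSemidef.zero, by rw [sub_zero]; exact hQpd.posSemidef⟩
  have hTm : Measurable T := (hch 0 h0).measurable_source
  have hYT : IndepFun Y T P := (hsource 0 h0).2.comp measurable_id measurable_fst
  have hbXT : bX =ᵐ[P] T := by
    have hXT : X = fun ω => T ω + matVec B (Y ω) := funext fun ω => (sub_add_cancel _ _).symm
    have h := centered_ae_eq hTm hYm (measurable_matVec B) (hch 0 h0).zeroMean_source hBY hYT
    rwa [← hXT, ← hbX] at h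
  have hbXhZ : ∀ S ∈ errorCovs Q, bXh S =ᵐ[P] Z S := by
    intro S hS
    have h := centered_ae_eq (hch S hS).measurable_repro hYm (measurable_matVec B)
      (hch S hS).zeroMean_repro hBY ((hsource S hS).2.comp measurable_id measurable_snd)
    rwa [← hXhZ S hS, ← hbXh] at h
  have hrXT : rX =ᵐ[P] fun ω => matVec Uᵀ (T ω) := by
    filter_upwards [hbXT] with ω hω
    rw [hrX, hω]
  have hrXhZ : ∀ S ∈ errorCovs Q, rXh S =ᵐ[P] fun ω => matVec Uᵀ (Z S ω) := by
    intro S hS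
    filter_upwards [hbXhZ S hS] with ω hω
    rw [hrXh, hω]
  have hrot : ∀ S ∈ errorCovs Q, IsTestChannel P (fun ω => matVec Uᵀ (T ω))
      (fun ω => matVec Uᵀ (Z S ω)) (Matrix.diagonal lam) (Uᵀ * S * U) := by
    intro S hS
    have h := (hch S hS).rotate Uᵀ
    rwa [Matrix.transpose_transpose, hQU, transpose_mul_conj_mul hU'] at h
  have hcoord : ∀ S ∈ errorCovs Q, ∀ t,
      mutualInfo P (fun ω => rX ω t) (fun ω => rXh S ω t) =
        mutualInfo P (fun ω => matVec Uᵀ (T ω) t) (fun ω => matVec Uᵀ (Z S ω) t) := by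
    intro S hS t
    refine mutualInfo_congr ?_ ?_
    · filter_upwards [hrXT] with ω hω
      rw [hω]
    · filter_upwards [hrXhZ S hS] with ω hω
      rw [hω]
  have hI : ∀ S ∈ errorCovs Q, mutualInfo P bX (bXh S) = mutualInfo P T (Z S) := fun S hS =>
    mutualInfo_congr hbXT (hbXhZ S hS)
  have hIr : ∀ S ∈ errorCovs Q, mutualInfo P rX (rXh S) =
      mutualInfo P (fun ω => matVec Uᵀ (T ω)) (fun ω => matVec Uᵀ (Z S ω)) := fun S hS =>
    mutualInfo_congr hrXT (hrXhZ S hS)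
  have hcond : ∀ S ∈ errorCovs Q, condMutualInfo P X (Xh S) Y = mutualInfo P bX (bXh S) := by
    intro S hS
    have hZS : Z S = fun ω => Xh S ω - matVec B (Y ω) := by
      rw [hXhZ S hS]
      exact funext fun ω => (add_sub_cancel_right _ _).symm
    have hind := (hsource S hS).2
    rw [hI S hS]
    rw [hZS] at hind ⊢
    exact condMutualInfo_eq_mutualInfo_sub hXmeas (hXhm S hS) hYm (measurable_matVec B) hind
  have hbr : ∀ S ∈ errorCovs Q, mutualInfo P bX (bXh S) = mutualInfo P rX (rXh S) := by
    intro S hS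
    have hinv : Function.LeftInverse (matVec U) (matVec Uᵀ) := fun x => by
      rw [matVec_matVec, hU, one_matVec]
    rw [hI S hS, hIr S hS]
    exact (mutualInfo_comp_of_leftInverse hTm (hch S hS).measurable_repro (measurable_matVec Uᵀ)
      (measurable_matVec U) (measurable_matVec Uᵀ) (measurable_matVec U) hinv hinv).symm
  have hsum : ∀ S ∈ errorCovs Q,
      ∑ t, mutualInfo P (fun ω => rX ω t) (fun ω => rXh S ω t) ≤ mutualInfo P rX (rXh S) := by
    intro S hS
    rw [hIr S hS, Finset.sum_congr rfl fun t _ => hcoord S hS t]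
    exact (hrot S hS).sum_mutualInfo_le_of_diagonal
  have herr : ∀ S ∈ errorCovs Q, HasSecondMoment P (fun ω => X ω - Xh S ω) S := by
    intro S hS
    have h : (fun ω => X ω - Xh S ω) = fun ω => T ω - Z S ω := by
      rw [hXhZ S hS]
      exact funext fun ω => by rw [hT, sub_sub, add_comm]
    rw [h]
    exact (hch S hS).moment_error
  have hdX := fun S hS => distortion_eq_of_hasSecondMoment (herr S hS)
  have hdb : ∀ S ∈ errorCovs Q, distortion P bX (bXh S) = ENNReal.ofReal S.trace := fun S hS =>
    (distortion_congr hbXT (hbXhZ S hS)).trans (hch S hS).distortion_eq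
  have hdr : ∀ S ∈ errorCovs Q, distortion P rX (rXh S) = ENNReal.ofReal S.trace := fun S hS =>
    (distortion_congr hrXT (hrXhZ S hS)).trans
      ((hrot S hS).distortion_eq.trans (by rw [trace_transpose_mul_mul hU]))
  -- the error covariances that are diagonal in the basis of `U`
  have hdiag : ∀ del : Fin nx → ℝ, U * Matrix.diagonal del * Uᵀ ∈ errorCovs Q →
      IsTestChannel P (fun ω => matVec Uᵀ (T ω))
        (fun ω => matVec Uᵀ (Z (U * Matrix.diagonal del * Uᵀ) ω))
        (Matrix.diagonal lam) (Matrix.diagonal del) := by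
    intro del hS
    have h := hrot _ hS
    rwa [transpose_mul_conj_mul hU'] at h
  have hdel : ∀ del : Fin nx → ℝ, U * Matrix.diagonal del * Uᵀ ∈ errorCovs Q →
      ∀ i, 0 ≤ del i ∧ del i ≤ lam i := fun del hS =>
    (mem_errorCovs_conj_iff hU').1 (hQU ▸ hS)
  have hdsum : ∀ del : Fin nx → ℝ, U * Matrix.diagonal del * Uᵀ ∈ errorCovs Q →
      ∑ t, mutualInfo P (fun ω => rX ω t) (fun ω => rXh (U * Matrix.diagonal del * Uᵀ) ω t) =
        ∑ i, scalarRate (lam i) (del i) := fun del hS =>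
    Finset.sum_congr rfl fun t _ => (hcoord _ hS t).trans
      ((hdiag del hS).mutualInfo_eval hlam0 (hdel del hS) t)
  have hdeq : ∀ del : Fin nx → ℝ, ∀ hS : U * Matrix.diagonal del * Uᵀ ∈ errorCovs Q,
      mutualInfo P rX (rXh (U * Matrix.diagonal del * Uᵀ)) =
        ∑ t, mutualInfo P (fun ω => rX ω t) (fun ω => rXh (U * Matrix.diagonal del * Uᵀ) ω t) := by
    intro del hS
    rw [hIr _ hS, (hdiag del hS).mutualInfo_eq_sum]
    exact Finset.sum_congr rfl fun t _ => (hcoord _ hS t).symm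
  have hdI : ∀ del : Fin nx → ℝ, U * Matrix.diagonal del * Uᵀ ∈ errorCovs Q →
      mutualInfo P rX (rXh (U * Matrix.diagonal del * Uᵀ)) = ∑ i, scalarRate (lam i) (del i) :=
    fun del hS => (hdeq del hS).trans (hdsum del hS)
  have hdb' : ∀ del : Fin nx → ℝ, U * Matrix.diagonal del * Uᵀ ∈ errorCovs Q →
      mutualInfo P bX (bXh (U * Matrix.diagonal del * Uᵀ)) = ∑ i, scalarRate (lam i) (del i) :=
    fun del hS => (hbr _ hS).trans (hdI del hS)
  have hdc : ∀ del : Fin nx → ℝ, U * Matrix.diagonal del * Uᵀ ∈ errorCovs Q →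
      condMutualInfo P X (Xh (U * Matrix.diagonal del * Uᵀ)) Y =
        ∑ i, scalarRate (lam i) (del i) :=
    fun del hS => (hcond _ hS).trans (hdb' del hS)
  have hsq : ∀ S ∈ errorCovs Q, ∀ i,
      ∫ ω, (rX ω i - rXh S ω i) ^ 2 ∂P = (Uᵀ * S * U) i i := by
    intro S hS i
    rw [← ((hrot S hS).integral_sub_sq i).2]
    refine integral_congr_ae ?_
    filter_upwards [hrXT, hrXhZ S hS] with ω h1 h2
    rw [h1, h2]
  -- all infima agree with the one over the distributions of the distortion
  have hfeas : ∀ Δ : ℝ, 0 ≤ Δ → ∀ S ∈ errorCovs Q,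
      (distortion P rX (rXh S) ≤ ENNReal.ofReal Δ ↔ S.trace ≤ Δ) := fun Δ hΔ S hS => by
    rw [hdr S hS, ENNReal.ofReal_le_ofReal_iff hΔ]
  have hfeas' : ∀ Δ : ℝ, 0 ≤ Δ → ∀ S ∈ errorCovs Q,
      (distortion P bX (bXh S) ≤ ENNReal.ofReal Δ ↔ S.trace ≤ Δ) := fun Δ hΔ S hS => by
    rw [hdb S hS, ENNReal.ofReal_le_ofReal_iff hΔ]
  have hcl : ∀ Δ : ℝ, 0 ≤ Δ → diagRDF lam Δ ≤ coordRDF (P.map rX) Δ := by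
    intro Δ hΔ
    refine diagRDF_le_coordRDF hlam0 (fun i => ?_) hΔ
    have hm : Measurable fun ω => matVec Uᵀ (T ω) := by fun_prop
    rw [Measure.map_congr hrXT, Measure.map_map (by fun_prop) hm]
    have h := map_eval_eq_gaussianReal (hrot 0 h0).hasGaussianLaw.fst (hrot 0 h0).zeroMean_source
      (hrot 0 h0).moment_source i
    rwa [Matrix.diagonal_apply_eq] at h
  have hcm : ∀ Δ : ℝ, coordRDF (P.map rX) Δ ≤ marginalRDF (P.map rX) Δ := by
    refine coordRDF_le_marginalRDF ?_
    have hm : Measurable fun ω => matVec Uᵀ (T ω) := by fun_prop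
    have h := iIndepFun_eval_of_diagonal (hrot 0 h0).hasGaussianLaw.fst
      (hrot 0 h0).zeroMean_source (hrot 0 h0).moment_source
    have := Measure.isProbabilityMeasure_map (μ := P) hm.aemeasurable
    rw [iIndepFun_iff_map_fun_eq_pi_map fun i => by fun_prop] at h
    rw [Measure.map_congr hrXT, iIndepFun_iff_map_fun_eq_pi_map fun i => by fun_prop,
      Measure.map_map (by fun_prop) hm]
    refine h.trans ?_
    congr 1
    funext i
    rw [Measure.map_map (by fun_prop) hm]
    rfl
  have hmm : ∀ Δ : ℝ, marginalRDF (P.map rX) Δ ≤ marginalRDF (P.map bX) Δ := by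
    intro Δ
    have h := marginalRDF_map_matVec_le (ν := P.map T) (A := Uᵀ)
      (by rw [Matrix.transpose_transpose, hU]) Δ
    rw [Measure.map_map (measurable_matVec Uᵀ) hTm] at h
    rw [Measure.map_congr hrXT, Measure.map_congr hbXT]
    exact h
  have hmc : ∀ Δ : ℝ, marginalRDF (P.map bX) Δ ≤ condRDF (P.map fun ω => (X ω, Y ω)) Δ := by
    intro Δ
    rw [Measure.map_congr hbXT]
    exact marginalRDF_le_condRDF hXmeas hYm B hYT Δ
  have hcd : ∀ Δ : ℝ, 0 ≤ Δ → condRDF (P.map fun ω => (X ω, Y ω)) Δ ≤ diagRDF lam Δ := by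
    intro Δ hΔ
    refine le_iInf₂ fun del hdel' => ?_
    -- The capped allocation defines an admissible channel, and capping does not change the cost.
    obtain ⟨hm, -⟩ := conj_diagonal_min_mem hU hU' hlam0 hQU hdel'
    have h := condRDF_le_condMutualInfo (Δ := Δ) hXmeas (hXhm _ hm.1) hYm
      (by rw [hdX _ hm.1]; exact ENNReal.ofReal_le_ofReal hm.2)
    rw [hdc _ hm.1] at h
    simpa only [scalarRate_min (hlam0 _)] using h
  -- Here the circle of inequalities closes.
  have hR : ∀ Δ : ℝ, 0 ≤ Δ → condRDF (P.map fun ω => (X ω, Y ω)) Δ = diagRDF lam Δ :=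
    fun Δ hΔ => le_antisymm (hcd Δ hΔ) ((hcl Δ hΔ).trans ((hcm Δ).trans ((hmm Δ).trans (hmc Δ))))
  have hlow : ∀ Δ : ℝ, 0 ≤ Δ → ∀ S ∈ feasible Q Δ, diagRDF lam Δ ≤
      ∑ t, mutualInfo P (fun ω => rX ω t) (fun ω => rXh S ω t) := by
    intro Δ hΔ S hS
    refine (hcl Δ hΔ).trans ?_
    rw [Measure.map_congr hrXT, Finset.sum_congr rfl fun t _ => hcoord S hS.1 t]
    refine coordRDF_le_sum_mutualInfo (hrot S hS.1).measurable_source (hrot S hS.1).measurable_repro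
      ?_
    rw [(hrot S hS.1).distortion_eq, trace_transpose_mul_mul hU]
    exact ENNReal.ofReal_le_ofReal hS.2
  have hlow_r : ∀ Δ : ℝ, 0 ≤ Δ → ∀ S ∈ feasible Q Δ, diagRDF lam Δ ≤ mutualInfo P rX (rXh S) :=
    fun Δ hΔ S hS => (hlow Δ hΔ S hS).trans (hsum S hS.1)
  have hlow_b : ∀ Δ : ℝ, 0 ≤ Δ → ∀ S ∈ feasible Q Δ, diagRDF lam Δ ≤ mutualInfo P bX (bXh S) :=
    fun Δ hΔ S hS => (hlow_r Δ hΔ S hS).trans (hbr S hS.1).ge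
  have hlow_c : ∀ Δ : ℝ, 0 ≤ Δ → ∀ S ∈ feasible Q Δ,
      diagRDF lam Δ ≤ condMutualInfo P X (Xh S) Y :=
    fun Δ hΔ S hS => (hlow_b Δ hΔ S hS).trans (hcond S hS.1).ge
  have hsumInf : ∀ Δ : ℝ, 0 ≤ Δ → diagRDF lam Δ =
      ⨅ S ∈ {S | S ∈ errorCovs Q ∧ distortion P rX (rXh S) ≤ ENNReal.ofReal Δ},
        ∑ t, mutualInfo P (fun ω => rX ω t) (fun ω => rXh S ω t) := fun Δ hΔ =>
    diagRDF_eq_biInf hU hU' hlam0 hQU (fun S hS _ => ⟨hS.1, (hfeas Δ hΔ S hS.1).2 hS.2⟩)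
      (fun S hS => hlow Δ hΔ S ⟨hS.1, (hfeas Δ hΔ S hS.1).1 hS.2⟩) hdsum
  have hcoordR : ∀ Δ : ℝ, 0 ≤ Δ → diagRDF lam Δ = coordRDF (P.map rX) Δ := fun Δ hΔ =>
    le_antisymm (hcl Δ hΔ) ((hcm Δ).trans ((hmm Δ).trans ((hmc Δ).trans (hcd Δ hΔ))))
  refine ⟨hbXT, HasSecondMoment.congr (hch 0 h0).moment_source hbXT.symm, ?_, ?_, ?_, ?_,
    ?_⟩
  · intro S hS
    refine ⟨?_, ?_, hcond S hS, hbr S hS, herr S hS, (hdX S hS).trans (hdb S hS).symm,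
      (hdb S hS).trans (hdr S hS).symm, hdr S hS, hsum S hS⟩
    · refine (hbXhZ S hS).trans (Filter.EventuallyEq.of_eq (funext fun ω => ?_))
      rw [hXhZ S hS]
      exact (add_sub_cancel_right _ _).symm
    · filter_upwards [hbXT, hbXhZ S hS] with ω h1 h2
      rw [h1, h2]
  · intro Δ hΔ
    rw [hR Δ hΔ]
    refine ⟨?_, ?_, ?_, ?_, (hsumInf Δ hΔ).ge, ?_, ?_, (hcoordR Δ hΔ).ge⟩
    · exact diagRDF_eq_biInf hU hU' hlam0 hQU (fun S hS _ => hS) (hlow_c Δ hΔ) hdc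
    · exact diagRDF_eq_biInf hU hU' hlam0 hQU (fun S hS _ => hS) (fun S hS => diagRDF_le_detRate hU hU' hlam0 hQU hS)
        fun del hS => by
          have h := detRate_conj hU hU' (hdel del hS)
          rwa [← hQU] at h
    · exact diagRDF_eq_biInf hU hU' hlam0 hQU (fun S hS _ => ⟨hS.1, (hfeas' Δ hΔ S hS.1).2 hS.2⟩)
        (fun S hS => hlow_b Δ hΔ S ⟨hS.1, (hfeas' Δ hΔ S hS.1).1 hS.2⟩) hdb'
    · exact diagRDF_eq_biInf hU hU' hlam0 hQU (fun S hS _ => ⟨hS.1, (hfeas Δ hΔ S hS.1).2 hS.2⟩)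
        (fun S hS => hlow_r Δ hΔ S ⟨hS.1, (hfeas Δ hΔ S hS.1).1 hS.2⟩) hdI
    · exact le_antisymm ((hcl Δ hΔ).trans ((hcm Δ).trans (hmm Δ))) ((hmc Δ).trans (hcd Δ hΔ))
    · exact le_antisymm ((hcl Δ hΔ).trans (hcm Δ)) ((hmm Δ).trans ((hmc Δ).trans (hcd Δ hΔ)))
  · intro S hS hc
    obtain ⟨U₁, del, hU₁, hU₁', hQ₁, hS₁⟩ :=
      exists_common_diagonalization hU hU' hQU hS.1.isHermitian hc
    refine ⟨?_, U₁, del, hU₁, hU₁', hQ₁, hS₁, ?_⟩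
    · rw [hQ₁, hS₁] at hS ⊢
      exact posSemidef_gain hU₁ hU₁' hlam0 hS
    -- In the common eigenbasis both Q and S become diagonal, so the coordinate pairs decouple.
    · have h := (hch S hS).rotate U₁ᵀ
      have hQ₂ : U₁ᵀ * Q * U₁ᵀᵀ = Matrix.diagonal lam := by
        rw [Matrix.transpose_transpose, hQ₁, transpose_mul_conj_mul hU₁']
      have hS₂ : U₁ᵀ * S * U₁ᵀᵀ = Matrix.diagonal del := by
        rw [Matrix.transpose_transpose, hS₁, transpose_mul_conj_mul hU₁']
      rw [hQ₂, hS₂] at h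
      have hX₁ : (fun ω => matVec U₁ᵀ (bX ω)) =ᵐ[P] fun ω => matVec U₁ᵀ (T ω) := by
        filter_upwards [hbXT] with ω hω
        rw [hω]
      have hZ₁ : (fun ω => matVec U₁ᵀ (bXh S ω)) =ᵐ[P] fun ω => matVec U₁ᵀ (Z S ω) := by
        filter_upwards [hbXhZ S hS] with ω hω
        rw [hω]
      rw [mutualInfo_congr hX₁ hZ₁, h.mutualInfo_eq_sum]
      refine Finset.sum_congr rfl fun t _ => mutualInfo_congr ?_ ?_
      · filter_upwards [hX₁] with ω hω
        rw [hω]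
      · filter_upwards [hZ₁] with ω hω
        rw [hω]
  · rintro S hS del rfl
    refine ⟨HasSecondMoment.congr (hdiag del hS).moment_error ?_, hdeq del hS, hdc del hS⟩
    filter_upwards [hrXT, hrXhZ _ hS] with ω h1 h2
    rw [h1, h2]
  · intro Δ hΔ
    rw [hR Δ hΔ]
    refine ⟨?_, ?_, hsumInf Δ hΔ, hcoordR Δ hΔ, ?_, rfl⟩
    · exact diagRDF_eq_biInf hU hU' hlam0 hQU (fun S hS hc => ⟨hS, hc⟩) (fun S hS => hlow_c Δ hΔ S hS.1) hdc
    · exact diagRDF_eq_biInf hU hU' hlam0 hQU (fun S hS hc => ⟨hS, hc⟩) (fun S hS => hlow Δ hΔ S hS.1) hdsum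
    · refine diagRDF_eq_biInf hU hU' hlam0 hQU (fun S hS hc => ⟨hS, hc⟩) (fun S hS => ?_) fun del hS => ?_
      -- The actual coordinate errors are the diagonal of UᵀSU, so they sum to tr S ≤ Δ and form an
      -- allocation themselves.
      · refine iInf₂_le (fun i => ∫ ω, (rX ω i - rXh S ω i) ^ 2 ∂P)
          ⟨fun i => integral_nonneg fun ω => sq_nonneg _, ?_⟩
        refine le_trans (le_of_eq ?_) hS.1.2
        rw [Finset.sum_congr rfl fun i _ => hsq S hS.1.1 i, ← trace_transpose_mul_mul hU]
        rfl
      · refine Finset.sum_congr rfl fun i _ => ?_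
        rw [hsq _ hS i, transpose_mul_conj_mul hU', Matrix.diagonal_apply_eq]
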